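/- **Setting.** Let $n\ge 1$, let $X\subset\mathbb R^n$ be compact (Euclidean norm $\|\cdot\|$), let $f:X\to X$ be continuous and let $\sigma>0$ be such that $f(x)+w\in X$ for all $x\in X$, $w\in[-\sigma,\sigma]^n$. Let $\Omega=([-\sigma,\sigma]^n)^{\mathbb N}$ carry the product probability $\mathbb P=(\nu^{\otimes n})^{\otimes\mathbb N}$, where $\nu$ is the uniform distribution on $[-\sigma,\sigma]$; let $\theta$ be the shift on $\Omega$, and put $f_\omega(x)=f(x)+\omega_0$, $f^k_\omega=f_{\theta^{k-1}\omega}\circ\dots\circ f_\omega$, $\Theta(\omega,x)=(\theta\omega,f_\omega(x))$. A probability measure $\mu$ on $X$ is stationary if $\mu(A)=\int_X\mathbb P(f_\omega(x)\in A)\,d\mu(x)$ for all Borel $A$, and an ergodic stationary measure if moreover $\mathbb P\otimes\mu$ is ergodic for $\Theta$. Let $df$ be the derivative of $f$ along $X$, and let the critical set $\mathcal C\subset X$ be the set of points where the (unique) derivative does not exist or is not invertible. Write $d(x)=\mathrm{dist}(x,\mathcal C)$. Assume: * $f$ is $C^{1+\alpha}$ on $X\setminus\mathcal C$ for some $\alpha\in(0,1]$,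 i.e. $df$ is locally $\alpha$-Hölder there. * (H1) $\mathcal C$ is contained in a finite union $M\subset X$ of images of $C^1$ maps $g_i:[0,1]^{n-1}\to\mathbb R^n$, and there is a map $v$ of class $C^1$ on $\mathcal C$ with $\|v\|=1$ and $v(g_i(t))\perp \mathrm{range}\,dg_i(t)$ whenever $g_i(t)\in\mathcal C$. There are $B>1$, $\beta>0$ such that, if $\mathcal C\neq\emptyset$: for all $x\in X\setminus\mathcal C$, $u\ne0$, $$\tfrac1B\,d(x)^\beta\le\frac{\|df(x)u\|}{\|u\|}\le B\,d(x)^{-\beta},$$ and for all $x,y\in X\setminus\mathcal C$ with $\|x-y\|\le d(x)/2$, both $\big|\log\|df(x)^{-1}\|-\log\|df(y)^{-1}\|\big|$ and $\big|\log|\det df(x)|-\log|\det df(y)|\big|$ are at most $\frac{B}{d(x)^\beta}\|x-y\|$. (Where $d(x)=0$ these bounds are void.) * (H2) $Y\subset X$ is a Borel set with $\mathbb P(f_\omega(x)\in Y)=1$ for every $x\in Y$; $\mu$ is the unique ergodic stationary probability measure with $\mu(Y)=1$; and $$\lambda:=\int_Y\log\|df(x)^{-1}\|\,d\mu(x)<0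 .$$ For $\delta>0$ let $\mathrm{dist}_\delta(x,\mathcal C)=1$ if $\mathrm{dist}(x,\mathcal C)>\delta$ and $\mathrm{dist}_\delta(x,\mathcal C)=\mathrm{dist}(x,\mathcal C)$ otherwise (with $\mathrm{dist}(x,\emptyset)=\infty$). For $k\ge1$ put $$S_k(\omega,x)=\frac1k\sum_{i=0}^k\log\|df(f^i_\omega(x))^{-1}\|,\qquad Z_k(\delta,\omega,x)=\frac1k\sum_{i=0}^k-\log\mathrm{dist}_\delta(f^i_\omega(x),\mathcal C),$$ where $\log\|df(y)^{-1}\|=+\infty$ for $y\in\mathcal C$ and $-\log0=+\infty$; for $k=0$ put $S_0=Z_0=0$. Let $m$ be Lebesgue measure. **Proposition 3.1.** There is $\varepsilon_0>0$ such that for every $\varepsilon\in(0,\varepsilon_0)$ there is $\delta_0>0$ such that for every $\delta\in(0,\delta_0)$ there are $C>1$, $\gamma\in(0,1)$ and measurable sets $A_k\subset X$ $(k\ge0)$ such that, for all $k\ge0$, $m(A_k)\le C\gamma^k$ and, for every $x\in Y\setminus A_k$, $$\mathbb P\big\{\,S_k(\omega,x)>\lambda+\varepsilon\ \text{ or }\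 Z_k(\delta,\omega,x)>\varepsilon\,\big\}<C\gamma^k .$$ -/

import Mathlib

open MeasureTheory Set
open scoped ENNReal

noncomputable section

/-- `ℝⁿ` with its Euclidean norm. -/
abbrev Euc (n : ℕ) : Type := EuclideanSpace ℝ (Fin n)

/-- The closed unit cube `[0,1]ᵏ`. -/
def unitCube (k : ℕ) : Set (Euc k) := {t | ∀ j, t j ∈ Icc (0 : ℝ) 1}

/-- The data of the random maps `f_ω(x) = f(x) + ω₀`: a compact set `X ⊆ ℝⁿ`, a map `f`, continuous
on `X` (its values outside `X` are never used), and a noise amplitude `σ > 0` such that every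
`x ↦ f x + w` with `w ∈ [-σ,σ]ⁿ` maps `X` to itself. -/
structure NoisySystem (n : ℕ) where
  X : Set (Euc n)
  f : Euc n → Euc n
  σ : ℝ
  isCompact_X : IsCompact X
  continuousOn_f : ContinuousOn f X
  σ_pos : 0 < σ
  maps_to : ∀ x ∈ X, ∀ w : Fin n → Icc (-σ) σ, f x + WithLp.toLp 2 (fun j => (w j : ℝ)) ∈ X

namespace NoisySystem

variable {n : ℕ} (S : NoisySystem n)

/-! ### The noise and the random compositions -/

/-- One noise value, a point of `[-σ,σ]ⁿ`. -/
abbrev Noise : Type := Fin n → Icc (-S.σ) S.σ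

/-- `Ω = ([-σ,σ]ⁿ)^ℕ`. -/
abbrev Ω : Type := ℕ → S.Noise

/-- `ν = Leb|_[-σ,σ] / (2σ)`. -/
def ν : Measure (Icc (-S.σ) S.σ) :=
  (ENNReal.ofReal (2 * S.σ))⁻¹ • Measure.comap Subtype.val (volume : Measure ℝ)

/-- `ℙ = (ν^{⊗ n})^{⊗ ℕ}`. -/
def ℙ : Measure S.Ω := Measure.infinitePi fun _ : ℕ => Measure.pi fun _ : Fin n => S.ν

/-- The shift on `Ω`. -/
def θ (ω : S.Ω) : S.Ω := fun i => ω (i + 1)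

/-- `f_ω(x) = f(x) + ω₀`. -/
def fω (ω : S.Ω) (x : S.X) : S.X :=
  ⟨S.f x + WithLp.toLp 2 (fun j => (ω 0 j : ℝ)), S.maps_to x x.2 (ω 0)⟩

/-- The random composition `f^k_ω = f_{θ^{k-1} ω} ∘ ⋯ ∘ f_ω`. -/
def iter : ℕ → S.Ω → S.X → S.X
  | 0, _, x => x
  | k + 1, ω, x => S.fω (S.θ^[k] ω) (iter k ω x)

/-- The skew product `Θ(ω,x) = (θ ω, f_ω(x))`. -/
def Θ (p : S.Ω × S.X) : S.Ω × S.X := (S.θ p.1, S.fω p.1 p.2)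

/-- `μ` is stationary: `μ(A) = ∫ 𝒫_x(A) dμ(x)` with `𝒫_x(A) = ℙ(f_ω(x) ∈ A)`. -/
def IsStationary (μ : Measure S.X) : Prop :=
  ∀ A : Set S.X, MeasurableSet A → μ A = ∫⁻ x, S.ℙ {ω | S.fω ω x ∈ A} ∂μ

/-- `μ` is an ergodic stationary probability measure: `ℙ ⊗ μ` is ergodic for the skew product. -/
def IsErgodicStationary (μ : Measure S.X) : Prop :=
  IsProbabilityMeasure μ ∧ S.IsStationary μ ∧ Ergodic S.Θ (S.ℙ.prod μ)

/-! ### The derivative and the critical set -/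

/-- The derivative of `f : X → X`, taken along `X`. -/
def df (x : Euc n) : Euc n →L[ℝ] Euc n := fderivWithin ℝ S.f S.X x

/-- The critical set `𝒞`: the points of `X` at which there is no (unique) derivative of
`f : X → X`, or at which the derivative is not invertible. -/
def crit : Set (Euc n) :=
  {x ∈ S.X | ¬ (UniqueDiffWithinAt ℝ S.X x ∧ DifferentiableWithinAt ℝ S.f S.X x ∧
    (S.df x).IsInvertible)}

/-- `‖df(x)⁻¹‖`, for `x ∈ X \ 𝒞`. -/
def normInv (x : Euc n) : ℝ := ‖(S.df x).inverse‖

/-- `log ‖df(x)⁻¹‖`, with value `+∞` on the critical set. -/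
def logNormInv (x : Euc n) : EReal :=
  open Classical in if x ∈ S.crit then ⊤ else ((Real.log (S.normInv x) : ℝ) : EReal)

/-- The `δ`-truncated distance to the critical set. The untruncated distance is extended-valued,
so that the distance to the empty set is `∞`. -/
def distTrunc (δ : ℝ) (x : Euc n) : ℝ≥0∞ :=
  if ENNReal.ofReal δ < Metric.infEDist x S.crit then 1 else Metric.infEDist x S.crit

/-- `S_k(ω,x) = (1/k) ∑_{i=0}^k log ‖df⁻¹(f^i_ω(x))‖`. -/
def Sav (k : ℕ) (ω : S.Ω) (x : S.X) : EReal :=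
  (∑ i ∈ Finset.range (k + 1), S.logNormInv (S.iter i ω x)) / (k : EReal)

/-- `Z_k(ω,x) = (1/k) ∑_{i=0}^k -log dist_δ(f^i_ω(x), 𝒞)`; here `-log 0 = +∞`. -/
def Zav (δ : ℝ) (k : ℕ) (ω : S.Ω) (x : S.X) : EReal :=
  (∑ i ∈ Finset.range (k + 1), -ENNReal.log (S.distTrunc δ (S.iter i ω x))) / (k : EReal)

/-! ### The hypotheses -/

/-- `f` is `C^{1+α}` on `X \ 𝒞` for some `α ∈ (0,1]`: the derivative, which exists there by the
definition of `𝒞`, is locally `α`-Hölder. -/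
def IsC1Holder : Prop :=
  ∃ α : ℝ, 0 < α ∧ α ≤ 1 ∧ ∀ x ∈ S.X \ S.crit, ∃ U ∈ nhds x, ∃ K : ℝ,
    ∀ y ∈ U ∩ (S.X \ S.crit), ∀ z ∈ U ∩ (S.X \ S.crit),
      ‖S.df y - S.df z‖ ≤ K * ‖y - z‖ ^ α

/-- `𝒞` lies in a hypersurface contained in `X` with finitely many components, the `i`-th of which
is parametrized by a `C¹` map `g i` on the closed cube `[0,1]^{n-1}` (hence with bounded Jacobian),
and on `𝒞` there is a unit normal direction `v` to this hypersurface, of class `C¹`. The maps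
`g i` may degenerate, as spherical coordinates do. -/
def CritInHypersurface : Prop :=
  ∃ (N : ℕ) (g : Fin N → Euc (n - 1) → Euc n) (v : Euc n → Euc n),
    (∀ i, ContDiffOn ℝ 1 (g i) (unitCube (n - 1))) ∧
    (∀ i, ∀ t ∈ unitCube (n - 1), g i t ∈ S.X) ∧
    (S.crit ⊆ ⋃ i, g i '' unitCube (n - 1)) ∧
    ContDiffOn ℝ 1 v S.crit ∧
    (∀ y ∈ S.crit, ‖v y‖ = 1) ∧
    (∀ i, ∀ t ∈ unitCube (n - 1), g i t ∈ S.crit →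
      ∀ u, inner ℝ (v (g i t)) (fderivWithin ℝ (g i) (unitCube (n - 1)) t u) = 0)

/-- The critical set is non-degenerate: with `d = dist(x, 𝒞)`, `B⁻¹ d^β ‖u‖ ≤ ‖df(x) u‖ ≤
B d^{-β} ‖u‖` off the critical set (with the powers of `d` cleared), and `log ‖df⁻¹‖` and
`log |det df|` are Lipschitz with constant `B / d^β` at scale `d / 2`.
If `𝒞` is empty then `d` is `0` here and these conditions are void. -/
def CritNondegenerate : Prop :=
  ∃ B β : ℝ, 1 < B ∧ 0 < β ∧
    (∀ x ∈ S.X \ S.crit, ∀ u : Euc n,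
      Metric.infDist x S.crit ^ β * ‖u‖ ≤ B * ‖S.df x u‖ ∧
      Metric.infDist x S.crit ^ β * ‖S.df x u‖ ≤ B * ‖u‖) ∧
    (∀ x ∈ S.X \ S.crit, ∀ y ∈ S.X \ S.crit, ‖x - y‖ ≤ Metric.infDist x S.crit / 2 →
      |Real.log (S.normInv x) - Real.log (S.normInv y)|
          ≤ B / Metric.infDist x S.crit ^ β * ‖x - y‖ ∧
      |Real.log (abs (S.df x).det) - Real.log (abs (S.df y).det)|
          ≤ B / Metric.infDist x S.crit ^ β * ‖x - y‖)

/-- `λ = ∫_Y log ‖df(x)⁻¹‖ dμ(x)`. -/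
def lam (Y : Set S.X) (μ : Measure S.X) : ℝ := ∫ x in Y, (S.logNormInv x).toReal ∂μ

/-- `Y` is an invariant ergodic component: from each of its points the process stays in `Y` almost
surely, and `μ` is the only ergodic stationary probability measure carried by `Y`. -/
def IsErgodicComponent (Y : Set S.X) (μ : Measure S.X) : Prop :=
  MeasurableSet Y ∧ (∀ x ∈ Y, ∀ᵐ ω ∂S.ℙ, S.fω ω x ∈ Y) ∧
    S.IsErgodicStationary μ ∧ μ Yᶜ = 0 ∧
    ∀ μ' : Measure S.X, S.IsErgodicStationary μ' → μ' Yᶜ = 0 → μ' = μ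

end NoisySystem

end

/-!
The noise gives the law of every step a density at most `(2σ)⁻ⁿ`. A neighbourhood of radius `r` of
a hypersurface has volume `O(r)`, so an observable with only logarithmic poles on `𝒞` has
exponential moments under the law of a step, uniformly in the starting point.

Time averages of the laws of the process started in `Y` become invariant, uniformly in the starting
point and in the test set, and they have bounded densities. Any stationary probability measure
carried by `Y` is `μ`, because its indecomposable pieces are ergodic for the skew product. Hence,
by compactness, the mean of such an observable `φ` over a long block is at most `∫ φ dμ + η`
uniformly on `Y`. The Chernoff bound over successive blocks makes deviations of the Birkhoff sums
exponentially unlikely. The initial point, which no noise has smoothed, is controlled by removing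
the `e^{-ck}`-neighbourhood of `𝒞`: this is `A_k`.

Apply this to `log ‖df⁻¹‖` and to `-log dist_δ(·, 𝒞)`, whose mean tends to `0` with `δ`.
-/

open Filter Topology
open ProbabilityTheory (Kernel IsMarkovKernel)

noncomputable section

/-! ### Setwise limits of dominated measures -/

section SetwiseLimit

variable {α ι : Type*} [MeasurableSpace α]

lemma exists_measure_eq_of_additive_le (ρ : Measure α) [IsFiniteMeasure ρ] (c : Set α → ℝ≥0∞)
    (hle : ∀ A, c A ≤ ρ A)
    (hadd : ∀ A B, MeasurableSet A → MeasurableSet B → Disjoint A B → c (A ∪ B) = c A + c B) :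
    ∃ m ≤ ρ, ∀ A, MeasurableSet A → m A = c A := by
  have hempty : c ∅ = 0 := by simpa using hle ∅
  have hring : IsSetRing {A : Set α | MeasurableSet A} :=
    ⟨.empty, fun _ _ => MeasurableSet.union, fun _ _ => MeasurableSet.diff⟩
  let content := hring.addContent_of_union c hempty fun {A B} hA hB => hadd A B hA hB
  have htendsto : ∀ ⦃s : ℕ → Set α⦄, (∀ i, MeasurableSet (s i)) → Antitone s → ⋂ i, s i = ∅ →
      Tendsto (fun i => c (s i)) atTop (𝓝 0) := fun s hs hanti hinter => by
    have hρ := tendsto_measure_iInter_atTop (μ := ρ) (fun i => (hs i).nullMeasurableSet) hanti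
      ⟨0, measure_ne_top _ _⟩
    rw [hinter, measure_empty] at hρ
    exact tendsto_of_tendsto_of_tendsto_of_le_of_le tendsto_const_nhds hρ (fun _ => zero_le)
      fun i => hle _
  have hiUnion : ∀ ⦃f : ℕ → Set α⦄, (∀ i, MeasurableSet (f i)) →
      Pairwise (Function.onFun Disjoint f) → c (⋃ i, f i) = ∑' i, c (f i) := fun f hf hd =>
    addContent_iUnion_eq_sum_of_tendsto_zero hring content
      (fun A _ => ((hle A).trans_lt (measure_lt_top ρ A)).ne) htendsto hf (.iUnion hf) hd
  refine ⟨.ofMeasurable (fun A _ => c A) hempty hiUnion, Measure.le_iff.2 fun A hA => ?_,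
    fun A hA => Measure.ofMeasurable_apply A hA⟩
  rw [Measure.ofMeasurable_apply A hA]
  exact hle A

lemma exists_measure_setwise_tendsto (U : Ultrafilter ι) (ρ : Measure α) [IsFiniteMeasure ρ]
    {ms : ι → Measure α} (hms : ∀ i, ms i ≤ ρ) :
    ∃ m ≤ ρ, ∀ A, MeasurableSet A → Tendsto (fun i => ms i A) U (𝓝 (m A)) := by
  have hlim : ∀ A, ∃ a, Tendsto (fun i => ms i A) U (𝓝 a) := fun A => by
    obtain ⟨a, -, ha⟩ := isCompact_univ.ultrafilter_le_nhds (U.map fun i => ms i A) (by simp)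
    exact ⟨a, ha⟩
  choose c hc using hlim
  obtain ⟨m, hm, hmc⟩ := exists_measure_eq_of_additive_le ρ c
    (fun A => le_of_tendsto (hc A) (.of_forall fun i => hms i A))
    fun A B _ hB hAB => tendsto_nhds_unique (hc (A ∪ B)) <|
      ((hc A).add (hc B)).congr fun i => (measure_union hAB hB).symm
  exact ⟨m, hm, fun A hA => hmc A hA ▸ hc A⟩

lemma dist_integral_le_of_le {m ρ : Measure α} (hm : m ≤ ρ) (g g' : α →₁[ρ] ℝ) :
    dist (∫ x, g x ∂m) (∫ x, g' x ∂m) ≤ dist g g' := by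
  have hg := L1.integrable_coeFn g
  have hg' := L1.integrable_coeFn g'
  rw [dist_eq_norm, ← integral_sub (hg.mono_measure hm) (hg'.mono_measure hm),
    L1.dist_eq_integral_dist]
  exact (norm_integral_le_integral_norm _).trans <|
    integral_mono_measure hm (.of_forall fun x => norm_nonneg _) (hg.sub hg').norm

lemma tendsto_integral_of_setwise_tendsto {l : Filter ι} {ρ m : Measure α} [IsFiniteMeasure ρ]
    {ms : ι → Measure α} (hms : ∀ i, ms i ≤ ρ) (hm : m ≤ ρ)
    (h : ∀ A, MeasurableSet A → Tendsto (fun i => ms i A) l (𝓝 (m A))) {g : α → ℝ}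
    (hg : Integrable g ρ) : Tendsto (fun i => ∫ x, g x ∂(ms i)) l (𝓝 (∫ x, g x ∂m)) := by
  have : IsFiniteMeasure m := isFiniteMeasure_of_le ρ hm
  have : ∀ i, IsFiniteMeasure (ms i) := fun i => isFiniteMeasure_of_le ρ (hms i)
  refine Integrable.induction (μ := ρ)
    (fun g => Tendsto (fun i => ∫ x, g x ∂(ms i)) l (𝓝 (∫ x, g x ∂m))) ?_ ?_ ?_ ?_ hg
  · intro c s hs _
    simp only [integral_indicator_const _ hs, smul_eq_mul]
    exact ((ENNReal.tendsto_toReal (measure_ne_top m s)).comp (h s hs)).mul_const c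
  · intro g₁ g₂ _ hg₁ hg₂ ht₁ ht₂
    simp only [Pi.add_apply]
    rw [integral_add (hg₁.mono_measure hm) (hg₂.mono_measure hm)]
    refine (ht₁.add ht₂).congr fun i => ?_
    rw [integral_add (hg₁.mono_measure (hms i)) (hg₂.mono_measure (hms i))]
  · refine isClosed_of_closure_subset fun g hg => Metric.tendsto_nhds.2 fun ε hε => ?_
    obtain ⟨g', hg', hgg'⟩ := Metric.mem_closure_iff.1 hg (ε / 3) (by positivity)
    filter_upwards [Metric.tendsto_nhds.1 hg' (ε / 3) (by positivity)] with i hi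
    calc dist (∫ x, g x ∂(ms i)) (∫ x, g x ∂m)
        ≤ dist (∫ x, g x ∂(ms i)) (∫ x, g' x ∂(ms i)) +
          dist (∫ x, g' x ∂(ms i)) (∫ x, g' x ∂m) + dist (∫ x, g' x ∂m) (∫ x, g x ∂m) :=
          dist_triangle4 _ _ _ _
      _ < ε := by
        have hi₁ := dist_integral_le_of_le (hms i) g g'
        have hi₂ := dist_integral_le_of_le hm g' g
        rw [dist_comm] at hi₂
        rw [dist_comm g' g] at hi₂
        rw [dist_comm (∫ x, g' x ∂m)]
        linarith
  · intro g g' hgg' _ ht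
    rw [integral_congr_ae ((Measure.absolutelyContinuous_of_le hm).ae_eq hgg'.symm)]
    exact ht.congr fun i =>
      integral_congr_ae ((Measure.absolutelyContinuous_of_le (hms i)).ae_eq hgg')

end SetwiseLimit

/-! ### Invariant measures of a Markov kernel with dominated transition laws -/

section MarkovKernel

variable {E : Type*} [MeasurableSpace E] {κ : Kernel E E} {m μ ρ : Measure E}

/-- `B` is almost surely neither entered nor left by the Markov chain with transition kernel `κ`
and initial law `m`. -/
def IsInvariantSet (κ : Kernel E E) (m : Measure E) (B : Set E) : Prop :=
  ∀ᵐ x ∂m, ∀ᵐ y ∂κ x, (y ∈ B ↔ x ∈ B)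

/-- The Markov chain with transition kernel `κ` and initial law `m` has only trivial invariant sets.
For a `κ`-invariant probability measure `m` this is ergodicity of the chain. -/
def IsIndecomposable (κ : Kernel E E) (m : Measure E) : Prop :=
  ∀ B, MeasurableSet B → IsInvariantSet κ m B → m B = 0 ∨ m Bᶜ = 0

lemma IsInvariantSet.compl {B : Set E} (hB : IsInvariantSet κ m B) : IsInvariantSet κ m Bᶜ := by
  filter_upwards [hB] with x hx
  filter_upwards [hx] with y hy
  exact not_congr hy

lemma IsInvariantSet.inter_of_cond [IsFiniteMeasure m] {A B : Set E} (hA : MeasurableSet A)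
    (hinv : IsInvariantSet κ m A) (hB : IsInvariantSet κ (ProbabilityTheory.cond m A) B) :
    IsInvariantSet κ m (A ∩ B) := by
  have hB' : ∀ᵐ x ∂m, x ∈ A → ∀ᵐ y ∂κ x, (y ∈ B ↔ x ∈ B) := (ae_restrict_iff' hA).1 <|
    (Measure.ae_ennreal_smul_measure_iff (ENNReal.inv_ne_zero.2 (measure_ne_top m A))).1 hB
  filter_upwards [hinv, hB'] with x hxA hxB
  by_cases hx : x ∈ A
  · filter_upwards [hxA, hxB hx] with y hyA hyB
    exact and_congr hyA hyB
  · filter_upwards [hxA] with y hyA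
    exact iff_of_false (fun hy => hx (hyA.1 hy.1)) fun hx' => hx hx'.1

lemma lintegral_kernel_apply (hm : κ.Invariant m) {A : Set E} (hA : MeasurableSet A) :
    ∫⁻ x, κ x A ∂m = m A := by
  conv_rhs => rw [← hm.def, Measure.bind_apply hA κ.aemeasurable]

lemma invariant_smul (hm : κ.Invariant m) (a : ℝ≥0∞) : κ.Invariant (a • m) := by
  rw [Kernel.Invariant, Measure.bind_smul, hm.def]

lemma invariant_restrict (hm : κ.Invariant m) {B : Set E} (hBm : MeasurableSet B)
    (hB : IsInvariantSet κ m B) : κ.Invariant (m.restrict B) := by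
  refine Measure.ext fun A hA => ?_
  rw [Measure.bind_apply hA κ.aemeasurable, Measure.restrict_apply hA,
    ← lintegral_kernel_apply hm (hA.inter hBm), ← lintegral_indicator hBm]
  refine lintegral_congr_ae ?_
  filter_upwards [hB] with x hx
  by_cases hxB : x ∈ B
  · rw [indicator_of_mem hxB]
    refine measure_congr ?_
    filter_upwards [hx] with y hy
    exact propext (and_iff_left (hy.2 hxB)).symm
  · rw [indicator_of_notMem hxB, eq_comm, measure_eq_zero_iff_ae_notMem]
    filter_upwards [hx] with y hy hyAB
    exact hxB (hy.1 hyAB.2)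

lemma invariant_cond (hm : κ.Invariant m) {B : Set E} (hBm : MeasurableSet B)
    (hB : IsInvariantSet κ m B) : κ.Invariant (ProbabilityTheory.cond m B) :=
  invariant_smul (invariant_restrict hm hBm hB) _

lemma le_of_invariant [IsProbabilityMeasure m] (hm : κ.Invariant m) (hρ : ∀ x, κ x ≤ ρ) :
    m ≤ ρ := by
  refine Measure.le_iff.2 fun A hA => ?_
  rw [← lintegral_kernel_apply hm hA]
  exact (lintegral_mono fun x => hρ x A).trans_eq (by simp)

lemma one_le_measure_of_isInvariantSet [IsFiniteMeasure m] (hm : κ.Invariant m)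
    (hρ : ∀ x, κ x ≤ ρ) {B : Set E} (hBm : MeasurableSet B) (hB : IsInvariantSet κ m B)
    (hB0 : m B ≠ 0) : 1 ≤ ρ B := by
  have := ProbabilityTheory.cond_isProbabilityMeasure hB0
  exact (ProbabilityTheory.cond_apply_self hB0 (measure_ne_top m B)).symm.trans_le
    (le_of_invariant (invariant_cond hm hBm hB) hρ B)

/-- Splitting an invariant set into two invariant pieces costs `ρ`-mass at least `1` each time. -/
lemma exists_isIndecomposable_cond_of_lt [IsFiniteMeasure m] (hm : κ.Invariant m)
    (hρ : ∀ x, κ x ≤ ρ) (j : ℕ) :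
    ∀ A, MeasurableSet A → IsInvariantSet κ m A → m A ≠ 0 → ρ A < j →
      ∃ B, MeasurableSet B ∧ IsInvariantSet κ m B ∧ m B ≠ 0 ∧
        IsIndecomposable κ (ProbabilityTheory.cond m B) := by
  induction j with
  | zero => intro A _ _ _ h; simp at h
  | succ j ih =>
    intro A hAm hA hA0 hlt
    by_cases hind : IsIndecomposable κ (ProbabilityTheory.cond m A)
    · exact ⟨A, hAm, hA, hA0, hind⟩
    simp only [IsIndecomposable, not_forall, not_or] at hind
    obtain ⟨B, hBm, hB, hB0, hBc0⟩ := hind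
    have hpos : ∀ {D}, ProbabilityTheory.cond m A D ≠ 0 → m (A ∩ D) ≠ 0 := fun hD h0 =>
      hD (by rw [ProbabilityTheory.cond_apply hAm, h0, mul_zero])
    have hone : 1 ≤ ρ (A ∩ Bᶜ) := one_le_measure_of_isInvariantSet hm hρ (hAm.inter hBm.compl)
      (hA.inter_of_cond hAm hB.compl) (hpos hBc0)
    refine ih (A ∩ B) (hAm.inter hBm) (hA.inter_of_cond hAm hB) (hpos hB0) ?_
    have hsum : ρ (A ∩ B) + 1 < j + 1 := by
      calc ρ (A ∩ B) + 1 ≤ ρ (A ∩ B) + ρ (A \ B) := by rw [sdiff_eq]; gcongr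
        _ = ρ A := measure_inter_add_sdiff A hBm
        _ < j + 1 := by exact_mod_cast hlt
    exact lt_of_add_lt_add_right hsum

lemma exists_isIndecomposable_smul_le [IsFiniteMeasure ρ] [IsFiniteMeasure m] (hm : κ.Invariant m)
    (hρ : ∀ x, κ x ≤ ρ) (hm0 : m ≠ 0) :
    ∃ (s : ℝ≥0∞) (m' : Measure E), s ≠ 0 ∧ IsProbabilityMeasure m' ∧ κ.Invariant m' ∧
      IsIndecomposable κ m' ∧ s • m' ≤ m := by
  obtain ⟨j, hj⟩ := ENNReal.exists_nat_gt (measure_ne_top ρ univ)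
  obtain ⟨B, hBm, hB, hB0, hind⟩ := exists_isIndecomposable_cond_of_lt hm hρ j univ .univ
    (.of_forall fun x => .of_forall fun y => by simp) (by simpa using hm0) hj
  refine ⟨m B, _, hB0, ProbabilityTheory.cond_isProbabilityMeasure hB0, invariant_cond hm hBm hB,
    hind, ?_⟩
  rw [ProbabilityTheory.cond, smul_smul, ENNReal.mul_inv_cancel hB0 (measure_ne_top m B), one_smul]
  exact Measure.restrict_le_self

lemma isGreatest_sSup_smul_le (μ m : Measure E) :
    IsGreatest {t : ℝ≥0∞ | t • μ ≤ m} (sSup {t : ℝ≥0∞ | t • μ ≤ m}) := by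
  refine ⟨Measure.le_iff'.2 fun A => ?_, fun t => le_sSup⟩
  rw [Measure.smul_apply, smul_eq_mul, sSup_eq_iSup, ENNReal.iSup_mul]
  refine iSup_le fun t => ?_
  rw [ENNReal.iSup_mul]
  exact iSup_le fun ht => ht A

lemma invariant_sub [IsFiniteMeasure m] (hm : κ.Invariant m) (hμ : κ.Invariant μ) (hle : μ ≤ m) :
    κ.Invariant (m - μ) := by
  have : IsFiniteMeasure μ := isFiniteMeasure_of_le m hle
  have hadd : m - μ + μ = m := Measure.sub_add_cancel_of_le hle
  refine Measure.ext fun A _ => ?_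
  have h : (m - μ).bind κ A + μ A = (m - μ) A + μ A := by
    calc (m - μ).bind κ A + μ A = ((m - μ).bind κ + μ.bind κ) A := by
          rw [hμ.def, Measure.add_apply]
      _ = (m - μ) A + μ A := by rw [← Measure.comp_add, hadd, hm.def, ← Measure.add_apply, hadd]
  exact (ENNReal.add_left_inj (measure_ne_top μ A)).1 h

/-- If `τ • μ ≤ m` with `τ` maximal and `m ≠ τ • μ`, an indecomposable measure below the remainder
`m - τ • μ` would have to be `μ` again, contradicting maximality. -/
lemma eq_of_invariant_of_forall_isIndecomposable [IsFiniteMeasure ρ] [IsProbabilityMeasure μ]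
    [IsProbabilityMeasure m] (hρ : ∀ x, κ x ≤ ρ) {Y : Set E} (hμ : κ.Invariant μ)
    (huniq : ∀ m' : Measure E, IsProbabilityMeasure m' → κ.Invariant m' → IsIndecomposable κ m' →
      m' Yᶜ = 0 → m' = μ)
    (hm : κ.Invariant m) (hmY : m Yᶜ = 0) : m = μ := by
  obtain ⟨hτm, hτmax⟩ := isGreatest_sSup_smul_le μ m
  set τ := sSup {t : ℝ≥0∞ | t • μ ≤ m}
  have hτ1 : τ ≤ 1 := by simpa using hτm univ
  have hadd : m - τ • μ + τ • μ = m := by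
    have : IsFiniteMeasure (τ • μ) := isFiniteMeasure_of_le m hτm
    exact Measure.sub_add_cancel_of_le hτm
  by_cases hr0 : m - τ • μ = 0
  · rw [hr0, zero_add] at hadd
    have hτ : τ = 1 := by simpa using congrArg (· univ) hadd
    rw [← hadd, hτ, one_smul]
  exfalso
  have : IsFiniteMeasure (m - τ • μ) := isFiniteMeasure_of_le m Measure.sub_le
  obtain ⟨s, m', hs, hm'p, hm', hind, hle⟩ := exists_isIndecomposable_smul_le
    (invariant_sub hm (invariant_smul hμ τ) hτm) hρ hr0
  have hm'Y : m' Yᶜ = 0 := by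
    have hsY : s * m' Yᶜ ≤ m Yᶜ := (hle.trans Measure.sub_le) Yᶜ
    rw [hmY, nonpos_iff_eq_zero, mul_eq_zero] at hsY
    exact hsY.resolve_left hs
  obtain rfl := huniq m' hm'p hm' hind hm'Y
  have hmem : s + τ ≤ 0 + τ := by
    rw [zero_add]
    refine hτmax (?_ : (s + τ) • m' ≤ m)
    rw [add_smul]
    exact (add_le_add_left hle _).trans_eq hadd
  exact hs (nonpos_iff_eq_zero.1
    ((ENNReal.add_le_add_iff_right (hτ1.trans_lt ENNReal.one_lt_top).ne).1 hmem))

/-! ### Harmonic functions and time averages of a Markov kernel -/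

variable {Y : Set E}

lemma integral_kernel_real [IsMarkovKernel κ] {A : Set E}
    (hA : MeasurableSet A) : ∫ x, (κ x).real A ∂m = (m.bind κ).real A := by
  simp only [Measure.real]
  rw [integral_toReal (κ.measurable_coe hA).aemeasurable (.of_forall fun x => measure_lt_top _ _),
    Measure.bind_apply hA κ.aemeasurable]

/-- The conditional variance `∫ h² dκ x - h(x)²` has mean `0` under an invariant measure. -/
lemma ae_ae_eq_of_integral_eq [IsMarkovKernel κ] [IsProbabilityMeasure m] (hm : κ.Invariant m)
    {h : E → ℝ} (hh : Measurable h) {C : ℝ} (hC : ∀ x, |h x| ≤ C)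
    (hharm : ∀ x, ∫ y, h y ∂κ x = h x) : ∀ᵐ x ∂m, ∀ᵐ y ∂κ x, h y = h x := by
  have hsq : ∀ x, ‖h x ^ 2‖ ≤ C ^ 2 := fun x => by
    rw [norm_pow]
    exact pow_le_pow_left₀ (norm_nonneg _) (hC x) 2
  have hint (m' : Measure E) [IsProbabilityMeasure m'] : Integrable (fun x => h x ^ 2) m' :=
    .of_bound (hh.pow_const 2).aestronglyMeasurable (C ^ 2) (.of_forall hsq)
  have hL2 : ∀ x, MemLp h 2 (κ x) := fun x =>
    .of_bound hh.aestronglyMeasurable C (.of_forall hC)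
  have hvar : ∀ x, ProbabilityTheory.variance h (κ x) = ∫ y, h y ^ 2 ∂κ x - h x ^ 2 := fun x => by
    rw [ProbabilityTheory.variance_eq_sub (hL2 x), hharm]
    rfl
  have hintκ : Integrable (fun x => ∫ y, h y ^ 2 ∂κ x) m :=
    Integrable.of_bound (StronglyMeasurable.integral_kernel
      (hh.pow_const 2).stronglyMeasurable).aestronglyMeasurable (C ^ 2)
      (.of_forall fun x => by
        simpa using norm_integral_le_of_norm_le_const (μ := κ x) (.of_forall hsq))
  have hinv : ∫ x, ∫ y, h y ^ 2 ∂κ x ∂m = ∫ x, h x ^ 2 ∂m := by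
    have hbind : Integrable (fun x => h x ^ 2) (m.bind κ) := hm.def.symm ▸ hint m
    rw [Measure.comp_eq_comp_const_apply] at hbind
    conv_rhs => rw [← hm.def, Measure.comp_eq_comp_const_apply, Kernel.integral_comp hbind]
    rfl
  have hzero : ∫ x, ProbabilityTheory.variance h (κ x) ∂m = 0 := by
    simp only [hvar]
    rw [integral_sub hintκ (hint m), hinv, sub_self]
  have hae := (integral_eq_zero_iff_of_nonneg
    (fun x => ProbabilityTheory.variance_nonneg h (κ x))
    ((hintκ.sub (hint m)).congr (.of_forall fun x => (hvar x).symm))).1 hzero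
  filter_upwards [hae] with x hx
  filter_upwards [ProbabilityTheory.ae_eq_integral_of_variance_eq_zero (hL2 x) hx] with y hy
  rw [hy, hharm]

/-- A bounded harmonic function is a.e. constant: its superlevel set at its mean is invariant. -/
lemma IsIndecomposable.ae_eq_integral [IsMarkovKernel κ] [IsProbabilityMeasure m]
    (hind : IsIndecomposable κ m) (hm : κ.Invariant m) {h : E → ℝ} (hh : Measurable h) {C : ℝ}
    (hC : ∀ x, |h x| ≤ C) (hharm : ∀ x, ∫ y, h y ∂κ x = h x) : ∀ᵐ x ∂m, h x = ∫ y, h y ∂m := by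
  have hint : Integrable h m := .of_bound hh.aestronglyMeasurable C (.of_forall hC)
  have hmean : ∫ _, (∫ y, h y ∂m) ∂m = ∫ y, h y ∂m := by simp
  have hinv : IsInvariantSet κ m {x | ∫ y, h y ∂m < h x} := by
    filter_upwards [ae_ae_eq_of_integral_eq hm hh hC hharm] with x hx
    filter_upwards [hx] with y hy
    simp [hy]
  rcases hind _ (measurableSet_lt measurable_const hh) hinv with hz | hz
  · have hle : ∀ᵐ x ∂m, h x ≤ ∫ y, h y ∂m := by
      filter_upwards [measure_eq_zero_iff_ae_notMem.1 hz] with x hx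
      exact not_lt.1 hx
    exact (integral_eq_iff_of_ae_le hint (integrable_const _) hle).1 hmean.symm
  · have hle : ∀ᵐ x ∂m, ∫ y, h y ∂m ≤ h x := by
      filter_upwards [measure_eq_zero_iff_ae_notMem.1 hz] with x hx
      exact (not_not.1 hx).le
    filter_upwards [(integral_eq_iff_of_ae_le (integrable_const _) hint hle).1 hmean] with x hx
    exact hx.symm

instance isMarkovKernel_pow [IsMarkovKernel κ] (k : ℕ) : IsMarkovKernel (κ ^ k) := by
  induction k with
  | zero => exact inferInstanceAs (IsMarkovKernel Kernel.id)
  | succ k ih => exact inferInstanceAs (IsMarkovKernel ((κ ^ k).comp κ))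

lemma kernel_pow_succ_le [IsMarkovKernel κ] (hρ : ∀ x, κ x ≤ ρ) (k : ℕ) (x : E) :
    (κ ^ (k + 1)) x ≤ ρ := by
  refine Measure.le_iff.2 fun A hA => ?_
  rw [Kernel.pow_succ_apply_eq_lintegral κ k x hA]
  exact (lintegral_mono fun y => hρ y A).trans_eq (by simp)

lemma kernel_pow_compl_eq_zero (hYm : MeasurableSet Y) (hY : ∀ x ∈ Y, κ x Yᶜ = 0) (k : ℕ) {x : E}
    (hx : x ∈ Y) : (κ ^ k) x Yᶜ = 0 := by
  induction k with
  | zero =>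
    have hdirac : (κ ^ 0) x = Measure.dirac x := Kernel.id_apply x
    rw [hdirac, Measure.dirac_apply' x hYm.compl]
    simp [hx]
  | succ k ih =>
    rw [Kernel.pow_succ_apply_eq_lintegral κ k x hYm.compl,
      lintegral_eq_zero_iff (κ.measurable_coe hYm.compl)]
    filter_upwards [measure_eq_zero_iff_ae_notMem.1 ih] with y hy
    exact hY y (not_not.1 hy)

/-- The average of the laws at the times `1, …, N` of the Markov chain with transition kernel `κ`
started at `x`. -/
def timeAverage (κ : Kernel E E) (N : ℕ) (x : E) : Measure E :=
  (N : ℝ≥0∞)⁻¹ • ∑ i ∈ Finset.range N, (κ ^ (i + 1)) x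

lemma timeAverage_apply (N : ℕ) (x : E) (A : Set E) :
    timeAverage κ N x A = (N : ℝ≥0∞)⁻¹ * ∑ i ∈ Finset.range N, (κ ^ (i + 1)) x A := by
  rw [timeAverage, Measure.smul_apply, Measure.finsetSum_apply, smul_eq_mul]

lemma isProbabilityMeasure_timeAverage [IsMarkovKernel κ] {N : ℕ} (hN : N ≠ 0) (x : E) :
    IsProbabilityMeasure (timeAverage κ N x) := by
  refine ⟨?_⟩
  simp only [timeAverage_apply, measure_univ, Finset.sum_const, Finset.card_range, nsmul_eq_mul,
    mul_one]
  exact ENNReal.inv_mul_cancel (by exact_mod_cast hN) (ENNReal.natCast_ne_top N)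

lemma timeAverage_le [IsMarkovKernel κ] (hρ : ∀ x, κ x ≤ ρ) (N : ℕ) (x : E) :
    timeAverage κ N x ≤ ρ := by
  refine Measure.le_iff'.2 fun A => ?_
  calc timeAverage κ N x A ≤ (N : ℝ≥0∞)⁻¹ * ∑ _i ∈ Finset.range N, ρ A := by
        rw [timeAverage_apply]
        gcongr with i
        exact kernel_pow_succ_le hρ i x
    _ = (N : ℝ≥0∞)⁻¹ * N * ρ A := by simp [mul_assoc]
    _ ≤ ρ A := mul_le_of_le_one_left zero_le (ENNReal.inv_mul_le_one _)

lemma timeAverage_compl_eq_zero (hYm : MeasurableSet Y) (hY : ∀ x ∈ Y, κ x Yᶜ = 0) (N : ℕ) {x : E}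
    (hx : x ∈ Y) : timeAverage κ N x Yᶜ = 0 := by
  rw [timeAverage_apply, Finset.sum_eq_zero fun i _ => kernel_pow_compl_eq_zero hYm hY _ hx,
    mul_zero]

lemma integral_timeAverage [IsMarkovKernel κ] (hρ : ∀ x, κ x ≤ ρ) {φ : E → ℝ}
    (hφ : Integrable φ ρ) (N : ℕ) (x : E) :
    ∫ y, φ y ∂timeAverage κ N x =
      (N : ℝ)⁻¹ * ∑ i ∈ Finset.range N, ∫ y, φ y ∂(κ ^ (i + 1)) x := by
  rw [timeAverage, integral_smul_measure, integral_finsetSum_measure fun i _ =>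
    hφ.mono_measure (kernel_pow_succ_le hρ i x)]
  simp

lemma timeAverage_bind_add (N : ℕ) (x : E) {A : Set E} (hA : MeasurableSet A) :
    (timeAverage κ N x).bind κ A + (N : ℝ≥0∞)⁻¹ * (κ ^ 1) x A =
      timeAverage κ N x A + (N : ℝ≥0∞)⁻¹ * (κ ^ (N + 1)) x A := by
  rw [Measure.bind_apply hA κ.aemeasurable, timeAverage, lintegral_smul_measure,
    lintegral_finsetSum_measure, ← timeAverage, timeAverage_apply, smul_eq_mul, ← mul_add,
      ← mul_add]
  simp only [← Kernel.pow_succ_apply_eq_lintegral κ _ x hA]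
  rw [← Finset.sum_range_succ, Finset.sum_range_succ' (fun i => (κ ^ (i + 1)) x A)]

lemma abs_timeAverage_bind_sub_le [IsMarkovKernel κ] {N : ℕ} (hN : N ≠ 0) (x : E) {A : Set E}
    (hA : MeasurableSet A) :
    |((timeAverage κ N x).bind κ).real A - (timeAverage κ N x).real A| ≤ (N : ℝ)⁻¹ := by
  have := isProbabilityMeasure_timeAverage (κ := κ) hN x
  have hNtop : (N : ℝ≥0∞)⁻¹ ≠ ∞ := ENNReal.inv_ne_top.2 (by exact_mod_cast hN)
  have h := congrArg ENNReal.toReal (timeAverage_bind_add (κ := κ) N x hA)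
  rw [ENNReal.toReal_add (measure_ne_top _ _) (ENNReal.mul_ne_top hNtop (measure_ne_top _ _)),
    ENNReal.toReal_add (measure_ne_top _ _) (ENNReal.mul_ne_top hNtop (measure_ne_top _ _)),
    ENNReal.toReal_mul, ENNReal.toReal_mul, ENNReal.toReal_inv, ENNReal.toReal_natCast] at h
  have hbound (k : ℕ) : (N : ℝ)⁻¹ * ((κ ^ k) x).real A ∈ Icc 0 (N : ℝ)⁻¹ :=
    ⟨by positivity, mul_le_of_le_one_right (by positivity) measureReal_le_one⟩
  simp only [Measure.real] at hbound ⊢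
  rw [abs_le]
  constructor <;> linarith [(hbound 1).1, (hbound 1).2, (hbound (N + 1)).1, (hbound (N + 1)).2]

/-- Subsequential limits of the time averages along `Y` are invariant measures on `Y`. -/
lemma exists_invariant_setwise_tendsto_timeAverage [IsMarkovKernel κ] [IsFiniteMeasure ρ]
    (hρ : ∀ x, κ x ≤ ρ) (hYm : MeasurableSet Y) (hY : ∀ x ∈ Y, κ x Yᶜ = 0) {xs : ℕ → E}
    (hxs : ∀ N, xs N ∈ Y) (U : Ultrafilter ℕ) (hU : (U : Filter ℕ) ≤ atTop) :
    ∃ m ≤ ρ, IsProbabilityMeasure m ∧ κ.Invariant m ∧ m Yᶜ = 0 ∧ ∀ A, MeasurableSet A →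
      Tendsto (fun N => timeAverage κ (N + 1) (xs N) A) U (𝓝 (m A)) := by
  obtain ⟨m, hmρ, hm⟩ := exists_measure_setwise_tendsto U ρ fun N =>
    timeAverage_le hρ (N + 1) (xs N)
  have : IsFiniteMeasure m := isFiniteMeasure_of_le ρ hmρ
  have hprob (N : ℕ) : IsProbabilityMeasure (timeAverage κ (N + 1) (xs N)) :=
    isProbabilityMeasure_timeAverage N.succ_ne_zero _
  have hmp : IsProbabilityMeasure m :=
    ⟨tendsto_nhds_unique (hm univ .univ) (by simp)⟩
  have hmY : m Yᶜ = 0 := tendsto_nhds_unique (hm _ hYm.compl)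
    (by simp [timeAverage_compl_eq_zero hYm hY _ (hxs _)])
  refine ⟨m, hmρ, hmp, Measure.ext fun A hA => ?_, hmY, hm⟩
  have hκA : Integrable (fun y => (κ y).real A) ρ :=
    .of_bound (κ.measurable_coe hA).ennreal_toReal.aestronglyMeasurable 1
      (.of_forall fun y =>
        (Real.norm_of_nonneg measureReal_nonneg).trans_le measureReal_le_one)
  have hbind : Tendsto (fun N => ((timeAverage κ (N + 1) (xs N)).bind κ).real A) U
      (𝓝 ((m.bind κ).real A)) := by
    simp only [← integral_kernel_real hA]
    exact tendsto_integral_of_setwise_tendsto (fun N => timeAverage_le hρ _ _) hmρ hm hκA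
  have hreal : Tendsto (fun N => (timeAverage κ (N + 1) (xs N)).real A) U (𝓝 (m.real A)) :=
    (ENNReal.tendsto_toReal (measure_ne_top m A)).comp (hm A hA)
  have hsub : Tendsto (fun N => ((timeAverage κ (N + 1) (xs N)).bind κ).real A -
      (timeAverage κ (N + 1) (xs N)).real A) U (𝓝 0) :=
    squeeze_zero_norm (fun N => abs_timeAverage_bind_sub_le N.succ_ne_zero _ hA)
      ((tendsto_inv_atTop_nhds_zero_nat.comp (tendsto_add_atTop_nat 1)).mono_left hU)
  exact (measureReal_eq_measureReal_iff).1
    (sub_eq_zero.1 (tendsto_nhds_unique (hbind.sub hreal) hsub))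

/-- If `μ` is the only invariant probability measure on the absorbing set `Y`, the time averages of
`φ` are eventually at most its space average, uniformly in the starting point. -/
lemma exists_sum_integral_pow_le [IsMarkovKernel κ] [IsFiniteMeasure ρ] (hρ : ∀ x, κ x ≤ ρ)
    (hYm : MeasurableSet Y) (hY : ∀ x ∈ Y, κ x Yᶜ = 0)
    (huniq : ∀ m, IsProbabilityMeasure m → κ.Invariant m → m Yᶜ = 0 → m = μ)
    {φ : E → ℝ} (hφ : Integrable φ ρ) {ε : ℝ} (hε : 0 < ε) :
    ∃ N : ℕ, 0 < N ∧ ∀ x ∈ Y,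
      ∑ i ∈ Finset.range N, ∫ y, φ y ∂(κ ^ (i + 1)) x ≤ N * (∫ y, φ y ∂μ + ε) := by
  by_contra! hcon
  choose! xs hxs hgt using fun N : ℕ => hcon (N + 1) N.succ_pos
  obtain ⟨m, hmρ, hmp, hminv, hmY, hm⟩ := exists_invariant_setwise_tendsto_timeAverage hρ hYm hY hxs
    (Ultrafilter.of atTop) (Ultrafilter.of_le atTop)
  have hlim := tendsto_integral_of_setwise_tendsto (fun N => timeAverage_le hρ (N + 1) (xs N)) hmρ
    hm hφ
  rw [huniq m hmp hminv hmY] at hlim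
  refine (lt_add_of_pos_right _ hε).not_ge (ge_of_tendsto hlim (.of_forall fun N => ?_))
  rw [integral_timeAverage hρ hφ, inv_mul_eq_div, le_div_iff₀ (by positivity), mul_comm]
  exact (hgt N).le

end MarkovKernel

/-! ### Random iterations -/

section PathSpace

variable {W : Type*}

/-- The left shift on sequences. -/
def shift (ω : ℕ → W) : ℕ → W := fun i => ω (i + 1)

/-- The cylinder set of the sequences whose first `N` terms lie in the sets `U i`. -/
def initialCylinder (N : ℕ) (U : ℕ → Set W) : Set (ℕ → W) := {ω | ∀ i < N, ω i ∈ U i}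

lemma initialCylinder_zero (U : ℕ → Set W) : initialCylinder 0 U = univ := by
  simp [initialCylinder]

lemma initialCylinder_succ (N : ℕ) (U : ℕ → Set W) :
    initialCylinder (N + 1) U =
      {ω | ω 0 ∈ U 0 ∧ shift ω ∈ initialCylinder N fun i => U (i + 1)} :=
  ext fun _ => Nat.forall_lt_succ_left

lemma initialCylinder_eq_pi (N : ℕ) (U : ℕ → Set W) :
    initialCylinder N U = (Finset.range N : Set ℕ).pi U := by
  ext ω
  simp [initialCylinder, Set.mem_pi]

variable [MeasurableSpace W]

@[fun_prop]
lemma measurable_shift : Measurable (shift : (ℕ → W) → ℕ → W) := by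
  unfold shift
  fun_prop

variable (W) in
/-- The π-system of the initial cylinders with measurable sides. -/
def measurableInitialCylinders : Set (Set (ℕ → W)) :=
  {s | ∃ N U, (∀ i, MeasurableSet (U i)) ∧ initialCylinder N U = s}

lemma univ_mem_measurableInitialCylinders : univ ∈ measurableInitialCylinders W :=
  ⟨0, fun _ => univ, fun _ => .univ, initialCylinder_zero _⟩

lemma measurableInitialCylinders_eq_squareCylinders :
    measurableInitialCylinders W = squareCylinders fun _ : ℕ => {s : Set W | MeasurableSet s} := by
  classical
  ext s
  constructor
  · rintro ⟨N, U, hU, rfl⟩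
    exact ⟨Finset.range N, U, fun i _ => hU i, initialCylinder_eq_pi N U⟩
  · rintro ⟨t, U, hU, rfl⟩
    refine ⟨t.sup id + 1, fun i => if i ∈ t then U i else univ, fun i => ?_, ?_⟩
    · beta_reduce
      split_ifs
      exacts [hU i (mem_univ i), .univ]
    · ext ω
      have hlt : ∀ i ∈ t, i < t.sup id + 1 := fun i hi =>
        Nat.lt_succ_of_le (Finset.le_sup (f := id) hi)
      simp only [initialCylinder, mem_ofPred_eq, Set.mem_pi, Finset.mem_coe]
      refine ⟨fun h i hi => by simpa only [if_pos hi] using h i (hlt i hi), fun h i _ => ?_⟩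
      split_ifs with hi
      exacts [h i hi, mem_univ _]

lemma generateFrom_measurableInitialCylinders :
    MeasurableSpace.generateFrom (measurableInitialCylinders W) = MeasurableSpace.pi := by
  rw [measurableInitialCylinders_eq_squareCylinders, generateFrom_squareCylinders]

lemma measurableSet_initialCylinder {N : ℕ} {U : ℕ → Set W} (hU : ∀ i, MeasurableSet (U i)) :
    MeasurableSet (initialCylinder N U) := by
  rw [initialCylinder_eq_pi]
  exact .pi (Finset.countable_toSet _) fun i _ => hU i

lemma isPiSystem_measurableInitialCylinders : IsPiSystem (measurableInitialCylinders W) := by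
  rw [measurableInitialCylinders_eq_squareCylinders]
  exact isPiSystem_squareCylinders (fun _ => MeasurableSpace.isPiSystem_measurableSet)
    fun _ => MeasurableSet.univ

/-- A finite measure is finite and spanning on any family containing the whole space. -/
def finiteSpanningSetsInOfUnivMem {E : Type*} [MeasurableSpace E] (m : Measure E)
    [IsFiniteMeasure m] {C : Set (Set E)} (hC : univ ∈ C) : m.FiniteSpanningSetsIn C where
  set _ := univ
  set_mem _ := hC
  finite _ := measure_lt_top m univ
  spanning := iUnion_const univ

variable (law : Measure W) [IsProbabilityMeasure law]

lemma infinitePi_initialCylinder {N : ℕ} {U : ℕ → Set W} (hU : ∀ i, MeasurableSet (U i)) :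
    Measure.infinitePi (fun _ : ℕ => law) (initialCylinder N U) =
      ∏ i ∈ Finset.range N, law (U i) := by
  rw [initialCylinder_eq_pi, Measure.infinitePi_pi _ fun i _ => hU i]

lemma infinitePi_initialCylinder_succ {N : ℕ} {U : ℕ → Set W} (hU : ∀ i, MeasurableSet (U i)) :
    Measure.infinitePi (fun _ : ℕ => law) (initialCylinder (N + 1) U) =
      law (U 0) * Measure.infinitePi (fun _ : ℕ => law) (initialCylinder N fun i => U (i + 1)) := by
  rw [infinitePi_initialCylinder law hU, infinitePi_initialCylinder law fun i => hU (i + 1),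
    Finset.prod_range_succ', mul_comm]

lemma measurePreserving_head_shift :
    MeasurePreserving (fun ω : ℕ → W => (ω 0, shift ω)) (Measure.infinitePi fun _ => law)
      (law.prod (Measure.infinitePi fun _ => law)) := by
  refine ⟨by fun_prop, (Measure.prod_eq_generateFrom MeasurableSpace.generateFrom_measurableSet
    generateFrom_measurableInitialCylinders MeasurableSpace.isPiSystem_measurableSet
    isPiSystem_measurableInitialCylinders law.toFiniteSpanningSetsIn
    (finiteSpanningSetsInOfUnivMem _ univ_mem_measurableInitialCylinders) ?_).symm⟩
  rintro A (hA : MeasurableSet A) _ ⟨N, U, hU, rfl⟩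
  have hpre : (fun ω : ℕ → W => (ω 0, shift ω)) ⁻¹' A ×ˢ initialCylinder N U =
      initialCylinder (N + 1) fun i => Nat.casesOn i A U := by
    rw [initialCylinder_succ]
    rfl
  have hU' : ∀ i, MeasurableSet (Nat.casesOn i A U : Set W) := fun i => by
    cases i
    exacts [hA, hU _]
  rw [Measure.map_apply (by fun_prop) (hA.prod (measurableSet_initialCylinder hU)), hpre,
    infinitePi_initialCylinder_succ _ hU']
  rfl

end PathSpace

/-- I.i.d. random maps: at each step a parameter `w` is drawn with distribution `law`, and the state
`x` moves to `step w x`. -/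
structure RandomMap (W E : Type*) [MeasurableSpace W] [MeasurableSpace E] where
  law : Measure W
  step : W → E → E
  isProbabilityMeasure_law : IsProbabilityMeasure law
  measurable_step : Measurable fun p : W × E => step p.1 p.2

namespace RandomMap

variable {W E : Type*} [MeasurableSpace W] [MeasurableSpace E] (F : RandomMap W E)

instance : IsProbabilityMeasure F.law := F.isProbabilityMeasure_law

/-- The law of the sequence of drawn parameters. -/
def pathLaw : Measure (ℕ → W) := Measure.infinitePi fun _ => F.law

instance : IsProbabilityMeasure F.pathLaw :=
  inferInstanceAs (IsProbabilityMeasure (Measure.infinitePi fun _ => F.law))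

lemma measurable_step_left (x : E) : Measurable fun w => F.step w x :=
  F.measurable_step.comp measurable_prodMk_right

/-- The transition kernel of the Markov chain of the successive states. -/
def transition : Kernel E E where
  toFun x := F.law.map fun w => F.step w x
  measurable' := by
    refine Measure.measurable_of_measurable_coe _ fun A hA => ?_
    simp only [Measure.map_apply (F.measurable_step_left _) hA]
    exact measurable_measure_prodMk_right (F.measurable_step hA)

lemma transition_apply (x : E) : F.transition x = F.law.map fun w => F.step w x := rfl

instance : IsMarkovKernel F.transition :=
  ⟨fun x => Measure.isProbabilityMeasure_map (F.measurable_step_left x).aemeasurable⟩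

lemma lintegral_transition {g : E → ℝ≥0∞} (hg : Measurable g) (x : E) :
    ∫⁻ y, g y ∂F.transition x = ∫⁻ w, g (F.step w x) ∂F.law := by
  rw [transition_apply, lintegral_map hg (F.measurable_step_left x)]

variable {F} {m : Measure E}

lemma measurePreserving_step [SFinite m] (hm : F.transition.Invariant m) :
    MeasurePreserving (fun p : W × E => F.step p.1 p.2) (F.law.prod m) m := by
  refine ⟨F.measurable_step, Measure.ext fun A hA => ?_⟩
  rw [Measure.map_apply F.measurable_step hA, Measure.prod_apply_symm (F.measurable_step hA),
    ← lintegral_kernel_apply hm hA]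
  refine lintegral_congr fun x => ?_
  rw [transition_apply, Measure.map_apply (F.measurable_step_left x) hA]
  rfl

variable (F)

/-- The state after `k` steps, the parameters being read off `ω`. -/
def iter : ℕ → (ℕ → W) → E → E
  | 0, _, x => x
  | k + 1, ω, x => iter k (shift ω) (F.step (ω 0) x)

@[fun_prop]
lemma measurable_iter (k : ℕ) : Measurable fun p : (ℕ → W) × E => F.iter k p.1 p.2 := by
  induction k with
  | zero => exact measurable_snd
  | succ k ih =>
    exact ih.comp ((measurable_shift.comp measurable_fst).prodMk
      (F.measurable_step.comp
        (((measurable_pi_apply 0).comp measurable_fst).prodMk measurable_snd)))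

lemma measurable_iter_left (k : ℕ) (x : E) : Measurable fun ω => F.iter k ω x :=
  (F.measurable_iter k).comp measurable_prodMk_right

lemma measurePreserving_head_shift :
    MeasurePreserving (fun ω : ℕ → W => (ω 0, shift ω)) F.pathLaw (F.law.prod F.pathLaw) :=
  _root_.measurePreserving_head_shift F.law

lemma lintegral_head_shift {g : W × (ℕ → W) → ℝ≥0∞} (hg : Measurable g) :
    ∫⁻ ω, g (ω 0, shift ω) ∂F.pathLaw = ∫⁻ w, ∫⁻ ω, g (w, ω) ∂F.pathLaw ∂F.law := by
  rw [F.measurePreserving_head_shift.lintegral_comp hg, lintegral_prod _ hg.aemeasurable]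

lemma map_iter (k : ℕ) (x : E) : F.pathLaw.map (fun ω => F.iter k ω x) = (F.transition ^ k) x := by
  induction k generalizing x with
  | zero =>
    have hdirac : (F.transition ^ 0) x = Measure.dirac x := Kernel.id_apply x
    rw [hdirac]
    simp [iter, Measure.map_const]
  | succ k ih =>
    refine Measure.ext fun A hA => ?_
    have hA' : MeasurableSet {p : W × (ℕ → W) | F.iter k p.2 (F.step p.1 x) ∈ A} :=
      (F.measurable_iter k).comp
        (measurable_snd.prodMk ((F.measurable_step_left x).comp measurable_fst)) hA
    rw [Measure.map_apply (F.measurable_iter_left _ x) hA,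
      show F.transition ^ (k + 1) = F.transition ^ (1 + k) by rw [add_comm],
      Kernel.pow_add_apply_eq_lintegral _ 1 k x hA, pow_one,
      F.lintegral_transition (Kernel.measurable_coe _ hA)]
    simp_rw [← ih, Measure.map_apply (F.measurable_iter_left k _) hA]
    exact (F.measurePreserving_head_shift.measure_preimage hA'.nullMeasurableSet).trans
      (Measure.prod_apply hA')

/-- The skew product over the shift. -/
def skewProduct (p : (ℕ → W) × E) : (ℕ → W) × E := (shift p.1, F.step (p.1 0) p.2)

variable {F}

lemma measurePreserving_skewProduct [SFinite m] (hm : F.transition.Invariant m) :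
    MeasurePreserving F.skewProduct (F.pathLaw.prod m) (F.pathLaw.prod m) := by
  have hhead := F.measurePreserving_head_shift.prod (MeasurePreserving.id m)
  have hswap := (Measure.measurePreserving_swap (μ := F.law) (ν := F.pathLaw)).prod
    (MeasurePreserving.id m)
  have hstep := (MeasurePreserving.id F.pathLaw).prod (measurePreserving_step hm)
  exact hstep.comp <| (measurePreserving_prodAssoc F.pathLaw F.law m).comp <| hswap.comp hhead

/-- The Markov property at time `1`, for a set which is invariant under the skew product. -/
lemma pathLaw_section_inter {D : Set ((ℕ → W) × E)} (hDm : MeasurableSet D)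
    (hD : F.skewProduct ⁻¹' D = D) {U : Set W} (hU : MeasurableSet U) {A : Set (ℕ → W)}
    (hA : MeasurableSet A) (x : E) :
    F.pathLaw {ω | (ω 0 ∈ U ∧ shift ω ∈ A) ∧ (ω, x) ∈ D} =
      ∫⁻ w in U, F.pathLaw {ω | ω ∈ A ∧ (ω, F.step w x) ∈ D} ∂F.law := by
  have hsec : MeasurableSet {p : W × (ℕ → W) | (p.2, F.step p.1 x) ∈ D} :=
    (measurable_snd.prodMk ((F.measurable_step_left x).comp measurable_fst)) hDm
  have hpre : {ω | (ω 0 ∈ U ∧ shift ω ∈ A) ∧ (ω, x) ∈ D} = (fun ω : ℕ → W => (ω 0, shift ω)) ⁻¹'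
      (U ×ˢ A ∩ {p : W × (ℕ → W) | (p.2, F.step p.1 x) ∈ D}) := by
    conv_lhs => rw [← hD]
    rfl
  have hm := (hU.prod hA).inter hsec
  rw [hpre, F.measurePreserving_head_shift.measure_preimage hm.nullMeasurableSet,
    Measure.prod_apply hm, ← lintegral_indicator hU]
  refine lintegral_congr fun w => ?_
  by_cases hw : w ∈ U
  · rw [indicator_of_mem hw]
    congr 1
    ext ω
    simp [hw]
  · rw [indicator_of_notMem hw]
    convert measure_empty (μ := F.pathLaw)
    ext ω
    simp [hw]

lemma ae_pathLaw_section_eq [IsProbabilityMeasure m] (hm : F.transition.Invariant m)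
    (hind : IsIndecomposable F.transition m) {D : Set ((ℕ → W) × E)} (hDm : MeasurableSet D)
    (hD : F.skewProduct ⁻¹' D = D) :
    ∀ᵐ x ∂m, F.pathLaw {ω | (ω, x) ∈ D} = F.pathLaw.prod m D := by
  have hh : Measurable fun x => F.pathLaw {ω | (ω, x) ∈ D} := measurable_measure_prodMk_right hDm
  have hharm (x : E) : ∫ y, F.pathLaw.real {ω | (ω, y) ∈ D} ∂F.transition x =
      F.pathLaw.real {ω | (ω, x) ∈ D} := by
    simp only [Measure.real]
    rw [integral_toReal hh.aemeasurable (.of_forall fun _ => measure_lt_top _ _),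
      F.lintegral_transition hh]
    have h := pathLaw_section_inter hDm hD .univ .univ x
    simp only [mem_univ, true_and, setLIntegral_univ] at h
    rw [h]
  filter_upwards [hind.ae_eq_integral hm hh.ennreal_toReal (C := 1)
    (fun x => by rw [abs_of_nonneg ENNReal.toReal_nonneg]; exact measureReal_le_one) hharm]
    with x hx
  rw [integral_toReal hh.aemeasurable (.of_forall fun _ => measure_lt_top _ _)] at hx
  refine (ENNReal.toReal_eq_toReal_iff' (measure_ne_top _ _) (measure_ne_top _ _)).1 ?_
  rw [Measure.prod_apply_symm hDm]
  exact hx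

lemma ae_pathLaw_initialCylinder_inter [IsProbabilityMeasure m] (hm : F.transition.Invariant m)
    (hind : IsIndecomposable F.transition m) {D : Set ((ℕ → W) × E)} (hDm : MeasurableSet D)
    (hD : F.skewProduct ⁻¹' D = D) (N : ℕ) {U : ℕ → Set W} (hU : ∀ i, MeasurableSet (U i)) :
    ∀ᵐ x ∂m, F.pathLaw {ω | ω ∈ initialCylinder N U ∧ (ω, x) ∈ D} =
      F.pathLaw.prod m D * F.pathLaw (initialCylinder N U) := by
  induction N generalizing U with
  | zero => simpa [initialCylinder_zero] using ae_pathLaw_section_eq hm hind hDm hD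
  | succ N ih =>
    have hstep := (measurePreserving_step hm).quasiMeasurePreserving.ae (ih fun i => hU (i + 1))
    have hswap := Measure.measurePreserving_swap.quasiMeasurePreserving.ae hstep
    filter_upwards [Measure.ae_ae_of_ae_prod hswap] with x hx
    rw [initialCylinder_succ]
    calc F.pathLaw {ω | (ω 0 ∈ U 0 ∧ shift ω ∈ initialCylinder N fun i => U (i + 1)) ∧ (ω, x) ∈ D}
        = ∫⁻ w in U 0, F.pathLaw {ω | ω ∈ initialCylinder N (fun i => U (i + 1)) ∧
            (ω, F.step w x) ∈ D} ∂F.law :=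
          pathLaw_section_inter hDm hD (hU 0) (measurableSet_initialCylinder fun i => hU (i + 1)) x
      _ = ∫⁻ _ in U 0, F.pathLaw.prod m D *
            F.pathLaw (initialCylinder N fun i => U (i + 1)) ∂F.law :=
          lintegral_congr_ae (ae_restrict_of_ae hx)
      _ = F.pathLaw.prod m D * F.pathLaw (initialCylinder (N + 1) U) := by
          rw [setLIntegral_const, pathLaw, infinitePi_initialCylinder_succ _ hU]
          ring
      _ = _ := by rw [initialCylinder_succ]

lemma restrict_prod_eq [IsProbabilityMeasure m] (hm : F.transition.Invariant m)
    (hind : IsIndecomposable F.transition m) {D : Set ((ℕ → W) × E)} (hDm : MeasurableSet D)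
    (hD : F.skewProduct ⁻¹' D = D) :
    (F.pathLaw.prod m).restrict D = F.pathLaw.prod m D • F.pathLaw.prod m := by
  set p := F.pathLaw.prod m D
  have := F.pathLaw.smul_finite (measure_ne_top (F.pathLaw.prod m) D)
  rw [← Measure.prod_smul_left]
  refine (Measure.prod_eq_generateFrom generateFrom_measurableInitialCylinders
    MeasurableSpace.generateFrom_measurableSet isPiSystem_measurableInitialCylinders
    MeasurableSpace.isPiSystem_measurableSet
    (finiteSpanningSetsInOfUnivMem (p • F.pathLaw) univ_mem_measurableInitialCylinders)
    m.toFiniteSpanningSetsIn ?_).symm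
  rintro _ ⟨N, U, hU, rfl⟩ A (hA : MeasurableSet A)
  have hrect := (measurableSet_initialCylinder (N := N) hU).prod hA
  rw [Measure.restrict_apply hrect, Measure.prod_apply_symm (hrect.inter hDm)]
  calc ∫⁻ x, F.pathLaw ((fun ω => (ω, x)) ⁻¹' (initialCylinder N U ×ˢ A ∩ D)) ∂m
      = ∫⁻ x in A, F.pathLaw {ω | ω ∈ initialCylinder N U ∧ (ω, x) ∈ D} ∂m := by
        rw [← lintegral_indicator hA]
        refine lintegral_congr fun x => ?_
        by_cases hx : x ∈ A <;> simp [hx, preimage, Set.mem_inter_iff]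
    _ = ∫⁻ _ in A, p * F.pathLaw (initialCylinder N U) ∂m :=
        lintegral_congr_ae <| ae_restrict_of_ae <|
          ae_pathLaw_initialCylinder_inter hm hind hDm hD N hU
    _ = (p • F.pathLaw) (initialCylinder N U) * m A := by
        rw [setLIntegral_const, Measure.smul_apply, smul_eq_mul]

/-- An invariant set is independent of every set, hence of itself. -/
lemma prod_eq_zero_or_one [IsProbabilityMeasure m] (hm : F.transition.Invariant m)
    (hind : IsIndecomposable F.transition m) {D : Set ((ℕ → W) × E)} (hDm : MeasurableSet D)
    (hD : F.skewProduct ⁻¹' D = D) : F.pathLaw.prod m D = 0 ∨ F.pathLaw.prod m D = 1 := by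
  have hmul : F.pathLaw.prod m D * F.pathLaw.prod m D = F.pathLaw.prod m D * 1 := by
    have h := congrArg (fun ρ : Measure _ => ρ D) (restrict_prod_eq hm hind hDm hD)
    simpa using h.symm
  by_cases h0 : F.pathLaw.prod m D = 0
  exacts [.inl h0, .inr ((ENNReal.mul_right_inj h0 (measure_ne_top _ _)).1 hmul)]

theorem ergodic_skewProduct [IsProbabilityMeasure m] (hm : F.transition.Invariant m)
    (hind : IsIndecomposable F.transition m) : Ergodic F.skewProduct (F.pathLaw.prod m) := by
  refine ⟨measurePreserving_skewProduct hm, ⟨fun D hDm hD => ?_⟩⟩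
  rw [Filter.eventuallyConst_set']
  rcases prod_eq_zero_or_one hm hind hDm hD with h | h
  exacts [.inl (ae_eq_empty.2 h), .inr (ae_eq_univ.2 ((prob_compl_eq_zero_iff hDm).2 h))]

end RandomMap

/-! ### Exponential moments and large deviations -/

/-- Geometric decay of a sequence in `[0, ∞]`. -/
def ExponentiallySmall (b : ℕ → ℝ≥0∞) : Prop :=
  ∃ C γ : ℝ, 0 < γ ∧ γ < 1 ∧ ∀ k, b k ≤ ENNReal.ofReal (C * γ ^ k)

lemma exp_mul_le_of_abs_le {s t u v : ℝ} (hs : 0 < s) (ht : 0 ≤ t) (hts : t ≤ s / 2)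
    (huv : |u| ≤ v) :
    Real.exp (t * u) ≤ 1 + t * u + t ^ 2 * (8 / s ^ 2 * Real.exp (s * v)) := by
  have htaylor : Real.exp (t * u) - (1 + t * u) ≤ (t * u) ^ 2 * Real.exp |t * u| := by
    refine (le_abs_self _).trans ?_
    rw [← Real.norm_eq_abs, ← Complex.norm_real, ← sq_abs (t * u)]
    simpa [Finset.sum_range_succ] using Complex.norm_exp_sub_sum_le_norm_mul_exp (t * u : ℝ) 2
  have hsq : u ^ 2 ≤ 8 / s ^ 2 * Real.exp (s / 2 * |u|) := by
    rw [div_mul_eq_mul_div, le_div_iff₀ (by positivity)]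
    have h := Real.pow_div_factorial_le_exp (s / 2 * |u|) (by positivity) 2
    norm_num [mul_pow] at h
    linarith
  have hexp : Real.exp |t * u| ≤ Real.exp (s / 2 * |u|) := by
    rw [abs_mul, abs_of_nonneg ht]
    gcongr
  calc Real.exp (t * u) ≤ 1 + t * u + t ^ 2 * (u ^ 2 * Real.exp |t * u|) := by linarith
    _ ≤ 1 + t * u +
        t ^ 2 * (8 / s ^ 2 * Real.exp (s / 2 * |u|) * Real.exp (s / 2 * |u|)) := by gcongr
    _ = 1 + t * u + t ^ 2 * (8 / s ^ 2 * Real.exp (s * |u|)) := by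
        rw [mul_assoc, ← Real.exp_add]
        ring_nf
    _ ≤ 1 + t * u + t ^ 2 * (8 / s ^ 2 * Real.exp (s * v)) := by gcongr

section ExpMoment

variable {Ω : Type*} [MeasurableSpace Ω] {P : Measure Ω} {U V : Ω → ℝ}

lemma integrable_exp_of_lintegral_ne_top (hV : Measurable V)
    (h : ∫⁻ ω, ENNReal.ofReal (Real.exp (V ω)) ∂P ≠ ∞) : Integrable (fun ω => Real.exp (V ω)) P :=
  (lintegral_ofReal_ne_top_iff_integrable hV.exp.aestronglyMeasurable
    (.of_forall fun _ => (Real.exp_pos _).le)).1 h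

lemma integrable_of_lintegral_exp_ne_top {s : ℝ} (hs : 0 < s) (hU : Measurable U)
    (hV : Measurable V) (hUV : ∀ ω, |U ω| ≤ V ω)
    (h : ∫⁻ ω, ENNReal.ofReal (Real.exp (s * V ω)) ∂P ≠ ∞) : Integrable U P := by
  refine ((integrable_exp_of_lintegral_ne_top (hV.const_mul s) h).const_mul s⁻¹).mono'
    hU.aestronglyMeasurable (.of_forall fun ω => (hUV ω).trans ?_)
  rw [← div_eq_inv_mul, le_div_iff₀ hs]
  linarith [Real.add_one_le_exp (s * V ω)]

lemma lintegral_exp_mul_le [IsProbabilityMeasure P] {s t M c : ℝ} (hs : 0 < s) (ht : 0 ≤ t)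
    (hts : t ≤ s / 2) (hU : Measurable U) (hV : Measurable V) (hUV : ∀ ω, |U ω| ≤ V ω)
    (hM0 : 0 ≤ M) (hM : ∫⁻ ω, ENNReal.ofReal (Real.exp (s * V ω)) ∂P ≤ ENNReal.ofReal M)
    (hc : ∫ ω, U ω ∂P ≤ c) :
    ∫⁻ ω, ENNReal.ofReal (Real.exp (t * U ω)) ∂P ≤
      ENNReal.ofReal (Real.exp (t * (c + t * (8 / s ^ 2 * M)))) := by
  have hfin := ne_top_of_le_ne_top ENNReal.ofReal_ne_top hM
  have hUint : Integrable U P := integrable_of_lintegral_exp_ne_top hs hU hV hUV hfin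
  have hVint := integrable_exp_of_lintegral_ne_top (hV.const_mul s) hfin
  have hlin : Integrable (fun ω => 1 + t * U ω) P := (integrable_const 1).add (hUint.const_mul t)
  have hquad : Integrable (fun ω => t ^ 2 * (8 / s ^ 2 * Real.exp (s * V ω))) P :=
    (hVint.const_mul _).const_mul _
  have hVM : ∫ ω, Real.exp (s * V ω) ∂P ≤ M := by
    rw [← ENNReal.ofReal_le_ofReal_iff hM0, ofReal_integral_eq_lintegral_ofReal hVint
      (.of_forall fun _ => (Real.exp_pos _).le)]
    exact hM
  have hle ω := exp_mul_le_of_abs_le hs ht hts (hUV ω)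
  calc ∫⁻ ω, ENNReal.ofReal (Real.exp (t * U ω)) ∂P
      ≤ ∫⁻ ω, ENNReal.ofReal (1 + t * U ω + t ^ 2 * (8 / s ^ 2 * Real.exp (s * V ω))) ∂P :=
        lintegral_mono fun ω => ENNReal.ofReal_le_ofReal (hle ω)
    _ = ENNReal.ofReal (1 + t * ∫ ω, U ω ∂P +
          t ^ 2 * (8 / s ^ 2 * ∫ ω, Real.exp (s * V ω) ∂P)) := by
        refine (ofReal_integral_eq_lintegral_ofReal (hlin.add hquad)
          (.of_forall fun ω => (Real.exp_pos _).le.trans (hle ω))).symm.trans ?_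
        rw [integral_add' hlin hquad, integral_add (integrable_const 1) (hUint.const_mul t),
          integral_const_mul, integral_const_mul, integral_const_mul, integral_const,
          probReal_univ, one_smul]
    _ ≤ ENNReal.ofReal (t * (c + t * (8 / s ^ 2 * M)) + 1) := by
        refine ENNReal.ofReal_le_ofReal ?_
        have h₁ : t * ∫ ω, U ω ∂P ≤ t * c := by gcongr
        have h₂ : t ^ 2 * (8 / s ^ 2 * ∫ ω, Real.exp (s * V ω) ∂P) ≤ t ^ 2 * (8 / s ^ 2 * M) := by
          gcongr
        linarith
    _ ≤ ENNReal.ofReal (Real.exp (t * (c + t * (8 / s ^ 2 * M)))) :=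
        ENNReal.ofReal_le_ofReal (Real.add_one_le_exp _)

end ExpMoment

namespace RandomMap

variable {W E : Type*} [MeasurableSpace W] [MeasurableSpace E] (F : RandomMap W E)

/-- The sum of the values of the observable `φ` at the times `1, …, k`. -/
def pathSum (φ : E → ℝ) (k : ℕ) (ω : ℕ → W) (x : E) : ℝ :=
  ∑ i ∈ Finset.range k, φ (F.iter (i + 1) ω x)

/-- The exponential moment of the sum of the values of `φ` at the times `1, …, k`. -/
def expMoment (φ : E → ℝ) (k : ℕ) (x : E) : ℝ≥0∞ :=
  ∫⁻ ω, ENNReal.ofReal (Real.exp (F.pathSum φ k ω x)) ∂F.pathLaw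

variable {F} {φ : E → ℝ} {ρ : Measure E} {Y : Set E}

lemma pathSum_succ (k : ℕ) (ω : ℕ → W) (x : E) :
    F.pathSum φ (k + 1) ω x =
      φ (F.step (ω 0) x) + F.pathSum φ k (shift ω) (F.step (ω 0) x) := by
  rw [pathSum, Finset.sum_range_succ', add_comm]
  rfl

lemma pathSum_const_mul (t : ℝ) (k : ℕ) (ω : ℕ → W) (x : E) :
    F.pathSum (fun y => t * φ y) k ω x = t * F.pathSum φ k ω x := by
  simp only [pathSum, Finset.mul_sum]

lemma abs_pathSum_le (k : ℕ) (ω : ℕ → W) (x : E) :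
    |F.pathSum φ k ω x| ≤ F.pathSum (fun y => |φ y|) k ω x :=
  Finset.abs_sum_le_sum_abs _ _

lemma measurable_pathSum (hφ : Measurable φ) (k : ℕ) :
    Measurable fun p : (ℕ → W) × E => F.pathSum φ k p.1 p.2 :=
  Finset.measurable_sum _ fun i _ => hφ.comp (F.measurable_iter (i + 1))

lemma measurable_pathSum_left (hφ : Measurable φ) (k : ℕ) (x : E) :
    Measurable fun ω => F.pathSum φ k ω x :=
  (measurable_pathSum hφ k).comp measurable_prodMk_right

lemma measurable_expMoment (hφ : Measurable φ) (k : ℕ) : Measurable (F.expMoment φ k) :=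
  (measurable_pathSum hφ k).exp.ennreal_ofReal.lintegral_prod_left'

lemma measurable_exp_mul_expMoment (hφ : Measurable φ) (k : ℕ) :
    Measurable fun y => ENNReal.ofReal (Real.exp (φ y)) * F.expMoment φ k y :=
  hφ.exp.ennreal_ofReal.mul (measurable_expMoment hφ k)

lemma expMoment_zero (x : E) : F.expMoment φ 0 x = 1 := by
  simp [expMoment, pathSum]

lemma expMoment_succ (hφ : Measurable φ) (k : ℕ) (x : E) :
    F.expMoment φ (k + 1) x =
      ∫⁻ y, ENNReal.ofReal (Real.exp (φ y)) * F.expMoment φ k y ∂F.transition x := by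
  have hm : Measurable fun p : W × (ℕ → W) =>
      ENNReal.ofReal (Real.exp (φ (F.step p.1 x) + F.pathSum φ k p.2 (F.step p.1 x))) := by
    have hstep : Measurable fun p : W × (ℕ → W) => F.step p.1 x :=
      (F.measurable_step_left x).comp measurable_fst
    exact ((hφ.comp hstep).add
      ((measurable_pathSum hφ k).comp (measurable_snd.prodMk hstep))).exp.ennreal_ofReal
  rw [F.lintegral_transition (measurable_exp_mul_expMoment hφ k), expMoment]
  simp only [pathSum_succ]
  rw [F.lintegral_head_shift hm]
  refine lintegral_congr fun w => ?_
  rw [expMoment,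
    ← lintegral_const_mul _ (measurable_pathSum_left hφ k _).exp.ennreal_ofReal]
  refine lintegral_congr fun ω => ?_
  rw [Real.exp_add, ENNReal.ofReal_mul (Real.exp_pos _).le]

lemma expMoment_le_pow (hρ : ∀ x, F.transition x ≤ ρ) (hφ : Measurable φ) (k : ℕ) (x : E) :
    F.expMoment φ k x ≤ (∫⁻ y, ENNReal.ofReal (Real.exp (φ y)) ∂ρ) ^ k := by
  induction k generalizing x with
  | zero => rw [expMoment_zero, pow_zero]
  | succ k ih =>
    rw [expMoment_succ hφ, pow_succ', ← lintegral_mul_const _ hφ.exp.ennreal_ofReal]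
    exact lintegral_mono' (hρ x) fun y => by gcongr; exact ih y

lemma expMoment_add_le (hY : ∀ x ∈ Y, F.transition x Yᶜ = 0) (hφ : Measurable φ) {k : ℕ}
    {b : ℝ≥0∞} (hb : ∀ y ∈ Y, F.expMoment φ k y ≤ b) (j : ℕ) :
    ∀ x ∈ Y, F.expMoment φ (j + k) x ≤ F.expMoment φ j x * b := by
  induction j with
  | zero => simpa only [expMoment_zero, zero_add, one_mul] using hb
  | succ j ih =>
    intro x hx
    rw [add_right_comm, expMoment_succ hφ, expMoment_succ hφ,
      ← lintegral_mul_const _ (measurable_exp_mul_expMoment hφ j)]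
    refine lintegral_mono_ae ?_
    filter_upwards [measure_eq_zero_iff_ae_notMem.1 (hY x hx)] with y hy
    rw [mul_assoc]
    gcongr
    exact ih y (not_not.1 hy)

lemma expMoment_mul_le (hY : ∀ x ∈ Y, F.transition x Yᶜ = 0) (hφ : Measurable φ) {N : ℕ}
    {b : ℝ≥0∞} (hb : ∀ y ∈ Y, F.expMoment φ N y ≤ b) (q : ℕ) :
    ∀ x ∈ Y, F.expMoment φ (q * N) x ≤ b ^ q := by
  induction q with
  | zero => intro x _; rw [zero_mul, expMoment_zero, pow_zero]
  | succ q ih =>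
    intro x hx
    rw [add_mul, one_mul, pow_succ]
    exact (expMoment_add_le hY hφ hb _ x hx).trans (by gcongr; exact ih x hx)

lemma exists_expMoment_le (hY : ∀ x ∈ Y, F.transition x Yᶜ = 0) (hφ : Measurable φ) {N : ℕ}
    (hN : 0 < N) {L : ℝ} (hL : ∀ k x, F.expMoment φ k x ≤ ENNReal.ofReal (L ^ k)) {b : ℝ}
    (hb : ∀ y ∈ Y, F.expMoment φ N y ≤ ENNReal.ofReal (Real.exp (b * N))) :
    ∃ C, ∀ x ∈ Y, ∀ k : ℕ, F.expMoment φ k x ≤ ENNReal.ofReal (C * Real.exp (b * k)) := by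
  refine ⟨max 1 (|L| * Real.exp (-b)) ^ N, fun x hx k => ?_⟩
  have hk : (k % N : ℕ) + (k / N : ℕ) * N = k := Nat.mod_add_div' k N
  have hkR : (k : ℝ) = (k % N : ℕ) + (k / N : ℕ) * N := by exact_mod_cast hk.symm
  calc F.expMoment φ k x
      ≤ F.expMoment φ (k % N) x * ENNReal.ofReal (Real.exp (b * N)) ^ (k / N) := by
        conv_lhs => rw [← hk]
        exact expMoment_add_le hY hφ (expMoment_mul_le hY hφ hb _) _ x hx
    _ ≤ ENNReal.ofReal (|L| ^ (k % N)) * ENNReal.ofReal (Real.exp (b * N)) ^ (k / N) := by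
        gcongr
        exact (hL _ x).trans (ENNReal.ofReal_le_ofReal (by rw [← abs_pow]; exact le_abs_self _))
    _ = ENNReal.ofReal ((|L| * Real.exp (-b)) ^ (k % N) * Real.exp (b * k)) := by
        rw [← ENNReal.ofReal_pow (Real.exp_pos _).le, ← ENNReal.ofReal_mul (by positivity),
          mul_pow, mul_assoc, ← Real.exp_nat_mul, ← Real.exp_nat_mul, ← Real.exp_add, hkR]
        ring_nf
    _ ≤ _ := by
        gcongr
        calc (|L| * Real.exp (-b)) ^ (k % N) ≤ max 1 (|L| * Real.exp (-b)) ^ (k % N) := by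
              gcongr; exact le_max_right _ _
          _ ≤ _ := pow_le_pow_right₀ (le_max_left _ _) (Nat.mod_lt k hN).le

lemma measure_le_pathSum_le (hφ : Measurable φ) (k : ℕ) (x : E) (c : ℝ) :
    F.pathLaw {ω | c ≤ F.pathSum φ k ω x} ≤ ENNReal.ofReal (Real.exp (-c)) * F.expMoment φ k x := by
  have hmarkov := mul_meas_ge_le_lintegral (μ := F.pathLaw)
    (measurable_pathSum_left (F := F) hφ k x).exp.ennreal_ofReal (ENNReal.ofReal (Real.exp c))
  simp only [ENNReal.ofReal_le_ofReal_iff (Real.exp_pos _).le, Real.exp_le_exp] at hmarkov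
  calc F.pathLaw {ω | c ≤ F.pathSum φ k ω x}
      = ENNReal.ofReal (Real.exp (-c)) *
          (ENNReal.ofReal (Real.exp c) * F.pathLaw {ω | c ≤ F.pathSum φ k ω x}) := by
        rw [← mul_assoc, ← ENNReal.ofReal_mul (Real.exp_pos _).le, ← Real.exp_add]
        simp
    _ ≤ _ := by gcongr; exact hmarkov

lemma integral_pathSum (hρ : ∀ x, F.transition x ≤ ρ) (hφ : Integrable φ ρ) (k : ℕ) (x : E) :
    ∫ ω, F.pathSum φ k ω x ∂F.pathLaw =
      ∑ i ∈ Finset.range k, ∫ y, φ y ∂(F.transition ^ (i + 1)) x := by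
  have hint (i : ℕ) : Integrable φ (F.pathLaw.map fun ω => F.iter (i + 1) ω x) := by
    rw [F.map_iter]
    exact hφ.mono_measure (kernel_pow_succ_le hρ i x)
  have hcomp (i : ℕ) : Integrable (fun ω => φ (F.iter (i + 1) ω x)) F.pathLaw :=
    (hint i).comp_measurable (F.measurable_iter_left (i + 1) x)
  simp only [pathSum]
  rw [integral_finsetSum _ fun i _ => hcomp i]
  refine Finset.sum_congr rfl fun i _ => ?_
  rw [← F.map_iter, integral_map (F.measurable_iter_left _ x).aemeasurable
    (hint i).aestronglyMeasurable]

/-- If the mean of a sum over one block of length `N` is at most `N a`, then so is, up to `ε` and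
for a small parameter `t`, the logarithm of its exponential moment. -/
lemma exists_expMoment_block_le (hρ : ∀ x, F.transition x ≤ ρ) (hφ : Measurable φ) {s : ℝ}
    (hs : 0 < s) (hexp : ∫⁻ y, ENNReal.ofReal (Real.exp (s * |φ y|)) ∂ρ ≠ ∞) {N : ℕ} (hN : 0 < N)
    {a : ℝ} (hmean : ∀ x ∈ Y, ∑ i ∈ Finset.range N, ∫ y, φ y ∂(F.transition ^ (i + 1)) x ≤ N * a)
    {ε : ℝ} (hε : 0 < ε) :
    ∃ t, 0 < t ∧ t ≤ s ∧
      ∀ x ∈ Y, F.expMoment (fun y => t * φ y) N x ≤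
        ENNReal.ofReal (Real.exp (t * (a + ε) * N)) := by
  set M : ℝ := ((∫⁻ y, ENNReal.ofReal (Real.exp (s * |φ y|)) ∂ρ) ^ N).toReal with hM
  have hM0 : 0 ≤ M := ENNReal.toReal_nonneg
  set κ : ℝ := 8 / s ^ 2 * M
  have hκ : 0 < κ + 1 := by positivity
  set t : ℝ := min (s / 2) (N * ε / (κ + 1))
  have hts : t ≤ s / 2 := min_le_left _ _
  have ht0 : 0 < t := by positivity
  have htκ : t * κ ≤ N * ε :=
    calc t * κ ≤ N * ε / (κ + 1) * (κ + 1) := by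
          gcongr
          exacts [min_le_right _ _, by linarith]
      _ = N * ε := div_mul_cancel₀ _ hκ.ne'
  refine ⟨t, ht0, by linarith, fun x hx => ?_⟩
  have hint : Integrable φ ρ :=
    integrable_of_lintegral_exp_ne_top hs hφ hφ.abs (fun _ => le_rfl) hexp
  have hmoment : ∫⁻ ω, ENNReal.ofReal (Real.exp (s * F.pathSum (fun y => |φ y|) N ω x)) ∂F.pathLaw ≤
      ENNReal.ofReal M := by
    rw [hM, ENNReal.ofReal_toReal (ENNReal.pow_ne_top hexp)]
    simpa only [expMoment, pathSum_const_mul] using expMoment_le_pow hρ (hφ.abs.const_mul s) N x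
  have hle := lintegral_exp_mul_le hs ht0.le hts (measurable_pathSum_left hφ N x)
    (measurable_pathSum_left hφ.abs N x) (fun ω => abs_pathSum_le N ω x) hM0 hmoment
    ((integral_pathSum hρ hint N x).trans_le (hmean x hx))
  simp only [expMoment, pathSum_const_mul]
  refine hle.trans (ENNReal.ofReal_le_ofReal (Real.exp_le_exp.2 ?_))
  calc t * (N * a + t * κ) ≤ t * (N * a + N * ε) := by gcongr
    _ = t * (a + ε) * N := by ring

/-- Exponential Chebyshev inequality, applied block by block. -/
theorem exponentiallySmall_measure_le_pathSum (hρ : ∀ x, F.transition x ≤ ρ)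
    (hY : ∀ x ∈ Y, F.transition x Yᶜ = 0) (hφ : Measurable φ) {s : ℝ} (hs : 0 < s)
    (hexp : ∫⁻ y, ENNReal.ofReal (Real.exp (s * |φ y|)) ∂ρ ≠ ∞) {N : ℕ} (hN : 0 < N) {a : ℝ}
    (hmean : ∀ x ∈ Y, ∑ i ∈ Finset.range N, ∫ y, φ y ∂(F.transition ^ (i + 1)) x ≤ N * a)
    {ε : ℝ} (hε : 0 < ε) (K : ℝ) :
    ∃ b, ExponentiallySmall b ∧
      ∀ x ∈ Y, ∀ k : ℕ, F.pathLaw {ω | k * (a + ε) - K ≤ F.pathSum φ k ω x} ≤ b k := by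
  obtain ⟨t, ht0, hts, hblock⟩ := exists_expMoment_block_le hρ hφ hs hexp hN hmean (half_pos hε)
  set L : ℝ := (∫⁻ y, ENNReal.ofReal (Real.exp (s * |φ y|)) ∂ρ).toReal
  have hpow (k : ℕ) (x : E) : F.expMoment (fun y => t * φ y) k x ≤ ENNReal.ofReal (L ^ k) := by
    rw [ENNReal.ofReal_pow ENNReal.toReal_nonneg, ENNReal.ofReal_toReal hexp]
    refine (expMoment_le_pow hρ (hφ.const_mul t) k x).trans (pow_le_pow_left₀ zero_le ?_ k)
    refine lintegral_mono fun y => ENNReal.ofReal_le_ofReal (Real.exp_le_exp.2 ?_)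
    calc t * φ y ≤ t * |φ y| := by gcongr; exact le_abs_self _
      _ ≤ s * |φ y| := by gcongr
  obtain ⟨C, hC⟩ := exists_expMoment_le hY (hφ.const_mul t) hN hpow hblock
  refine ⟨_, ⟨Real.exp (t * K) * C, Real.exp (-(t * (ε / 2))), Real.exp_pos _,
    Real.exp_lt_one_iff.2 (by linarith [mul_pos ht0 hε]), fun _ => le_rfl⟩, fun x hx k => ?_⟩
  calc F.pathLaw {ω | k * (a + ε) - K ≤ F.pathSum φ k ω x}
      = F.pathLaw {ω | t * (k * (a + ε) - K) ≤ F.pathSum (fun y => t * φ y) k ω x} := by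
        simp only [pathSum_const_mul, mul_le_mul_iff_right₀ ht0]
    _ ≤ ENNReal.ofReal (Real.exp (-(t * (k * (a + ε) - K)))) *
          ENNReal.ofReal (C * Real.exp (t * (a + ε / 2) * k)) :=
        (measure_le_pathSum_le (hφ.const_mul t) k x _).trans (by gcongr; exact hC x hx k)
    _ = ENNReal.ofReal (Real.exp (t * K) * C * Real.exp (-(t * (ε / 2))) ^ k) := by
        rw [← ENNReal.ofReal_mul (Real.exp_pos _).le, ← Real.exp_nat_mul, mul_left_comm,
          ← Real.exp_add, mul_comm (Real.exp (t * K)), mul_assoc C, ← Real.exp_add]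
        congr 3
        ring

end RandomMap

/-! ### Volume of tubes -/

section Tubes

open Module (finrank)

lemma exists_maximal_isSeparated {F : Type*} [PseudoEMetricSpace F] (r : ℝ≥0∞) (K : Set F) :
    ∃ N, Maximal (fun N => N ⊆ K ∧ Metric.IsSeparated r N) N := by
  refine zorn_subset {N | N ⊆ K ∧ Metric.IsSeparated r N} fun c hc hchain =>
    ⟨⋃₀ c, ⟨sUnion_subset fun N hN => (hc hN).1, ?_⟩, fun N hN => subset_sUnion_of_mem hN⟩
  exact (pairwise_sUnion hchain.directedOn).2 fun N hN => (hc hN).2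

variable {E F : Type*} [NormedAddCommGroup F] [NormedSpace ℝ F] [FiniteDimensional ℝ F]
  {K N : Set F}

/-- The balls of radius `r / 2` around the points of the set are disjoint. -/
lemma encard_mul_le_of_isSeparated {R : ℝ} {r : NNReal} (hr : 0 < r)
    (hN : N ⊆ Metric.closedBall 0 R) (hsep : Metric.IsSeparated r N) :
    (N.encard : ℝ≥0∞) * ENNReal.ofReal ((r / 2) ^ finrank ℝ F) ≤
      ENNReal.ofReal ((R + r) ^ finrank ℝ F) := by
  borelize F
  rcases N.eq_empty_or_nonempty with rfl | ⟨y₀, hy₀⟩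
  · simp
  have hR : 0 ≤ R := (norm_nonneg y₀).trans (mem_closedBall_zero_iff.1 (hN hy₀))
  have hr0 : (0 : ℝ) < r := hr
  have hdisj : Pairwise (Function.onFun Disjoint fun y : N => Metric.ball (y : F) (r / 2)) := by
    refine fun y z hyz => Metric.ball_disjoint_ball ?_
    have h : (r : ℝ≥0∞) < edist (y : F) z := hsep y.2 z.2 (Subtype.coe_ne_coe.2 hyz)
    rw [edist_dist, ← ENNReal.ofReal_coe_nnreal] at h
    linarith [(ENNReal.ofReal_lt_ofReal_iff_of_nonneg hr0.le).1 h]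
  have hsub : ⋃ y : N, Metric.ball (y : F) (r / 2) ⊆ Metric.ball 0 (R + r) :=
    iUnion_subset fun y => Metric.ball_subset_ball'
      (by linarith [Metric.mem_closedBall.1 (hN y.2)])
  refine (ENNReal.mul_le_mul_iff_left
    (Metric.measure_ball_pos (Measure.addHaar (G := F)) 0 one_pos).ne' measure_ball_lt_top.ne).1 ?_
  calc (N.encard : ℝ≥0∞) * ENNReal.ofReal ((r / 2) ^ finrank ℝ F) *
        Measure.addHaar (Metric.ball (0 : F) 1)
      = ∑' y : N, Measure.addHaar (Metric.ball (y : F) (r / 2)) := by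
        simp only [Measure.addHaar_ball_of_pos _ _ (half_pos hr0), ENNReal.tsum_const, mul_assoc]
        rfl
    _ ≤ Measure.addHaar (Metric.ball (0 : F) (R + r)) :=
        (tsum_meas_le_meas_iUnion_of_disjoint _ (fun _ => measurableSet_ball) hdisj).trans
          (measure_mono hsub)
    _ = ENNReal.ofReal ((R + r) ^ finrank ℝ F) * Measure.addHaar (Metric.ball (0 : F) 1) :=
        Measure.addHaar_ball_of_pos _ _ (by positivity)

lemma exists_finset_isCover (hK : Bornology.IsBounded K) (a : ℝ) :
    ∃ C : ℝ, ∀ r : NNReal, 0 < r → r ≤ a →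
      ∃ s : Finset F, ↑s ⊆ K ∧ Metric.IsCover r K (s : Set F) ∧
        s.card ≤ C / (r : ℝ) ^ finrank ℝ F := by
  obtain ⟨R, hR0, hR⟩ := hK.subset_closedBall_lt 0 0
  refine ⟨(2 * (R + a)) ^ finrank ℝ F, fun r hr hra => ?_⟩
  obtain ⟨N, hN⟩ := exists_maximal_isSeparated (r : ℝ≥0∞) K
  have hcard := encard_mul_le_of_isSeparated hr (hN.1.1.trans hR) hN.1.2
  have hfin : N.Finite := by
    rw [← encard_ne_top_iff]
    intro htop
    rw [htop, ENat.toENNReal_top, ENNReal.top_mul (by positivity)] at hcard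
    exact ENNReal.ofReal_ne_top (top_le_iff.1 hcard)
  lift N to Finset F using hfin
  refine ⟨N, hN.1.1, .of_maximal_isSeparated hN, ?_⟩
  rw [encard_coe_eq_coe_finsetCard, ENat.toENNReal_coe, ← ENNReal.ofReal_natCast,
    ← ENNReal.ofReal_mul (Nat.cast_nonneg _),
    ENNReal.ofReal_le_ofReal_iff (by positivity)] at hcard
  rw [le_div_iff₀ (by positivity)]
  calc (N.card : ℝ) * r ^ finrank ℝ F
      = N.card * (r / 2 : ℝ) ^ finrank ℝ F * 2 ^ finrank ℝ F := by
        rw [mul_assoc, ← mul_pow, div_mul_cancel₀ _ two_ne_zero]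
    _ ≤ (R + a) ^ finrank ℝ F * 2 ^ finrank ℝ F := by
        gcongr
        exact hcard.trans (by gcongr)
    _ = (2 * (R + a)) ^ finrank ℝ F := by rw [mul_comm, mul_pow]

variable [NormedAddCommGroup E] [NormedSpace ℝ E] [FiniteDimensional ℝ E] [MeasurableSpace E]
  [BorelSpace E]

lemma exists_measure_thickening_image_le (μ : Measure E) [μ.IsAddHaarMeasure]
    (hK : Bornology.IsBounded K) {g : F → E} {L : NNReal} (hg : LipschitzOnWith L g K) (a : ℝ) :
    ∃ C : ℝ, ∀ r : ℝ, 0 < r → r ≤ a →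
      μ (Metric.thickening r (g '' K)) ≤
        ENNReal.ofReal (C * r ^ (finrank ℝ E - finrank ℝ F : ℤ)) := by
  obtain ⟨C, hC⟩ := exists_finset_isCover hK a
  set V : ℝ := (μ (Metric.ball 0 1)).toReal
  have hV : μ (Metric.ball 0 1) = ENNReal.ofReal V :=
    (ENNReal.ofReal_toReal measure_ball_lt_top.ne).symm
  refine ⟨C * (L + 1) ^ finrank ℝ E * V, fun r hr hra => ?_⟩
  lift r to NNReal using hr.le
  obtain ⟨s, hsK, hcover, hcard⟩ := hC r (by exact_mod_cast hr) hra
  have hsub : Metric.thickening r (g '' K) ⊆ ⋃ y ∈ s, Metric.ball (g y) ((L + 1) * r) := by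
    intro z hz
    obtain ⟨_, ⟨x, hx, rfl⟩, hzx⟩ := Metric.mem_thickening_iff.1 hz
    obtain ⟨y, hy, hxy⟩ := mem_iUnion₂.1 (Metric.isCover_iff_subset_iUnion_closedBall.1 hcover hx)
    refine mem_iUnion₂.2 ⟨y, hy, ?_⟩
    calc dist z (g y) ≤ dist z (g x) + dist (g x) (g y) := dist_triangle _ _ _
      _ < r + L * r := add_lt_add_of_lt_of_le hzx
          ((hg.dist_le_mul x hx y (hsK hy)).trans (by gcongr; exact hxy))
      _ = (L + 1) * r := by ring
  calc μ (Metric.thickening r (g '' K)) ≤ ∑ y ∈ s, μ (Metric.ball (g y) ((L + 1) * r)) :=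
        (measure_mono hsub).trans (measure_biUnion_finset_le _ _)
    _ = ENNReal.ofReal (s.card * (((L + 1) * r) ^ finrank ℝ E * V)) := by
        simp only [Measure.addHaar_ball_of_pos μ _ (by positivity : 0 < ((L : ℝ) + 1) * r), hV,
          Finset.sum_const, nsmul_eq_mul, ← ENNReal.ofReal_natCast]
        rw [← ENNReal.ofReal_mul (by positivity), ← ENNReal.ofReal_mul (by positivity)]
    _ ≤ ENNReal.ofReal (C / (r : ℝ) ^ finrank ℝ F * (((L + 1) * r) ^ finrank ℝ E * V)) := by
        gcongr
    _ = _ := by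
        rw [zpow_sub₀ hr.ne', zpow_natCast, zpow_natCast, mul_pow]
        ring_nf

end Tubes

lemma lintegral_exp_mul_ne_top_of_measure_le {α : Type*} [MeasurableSpace α] {ρ : Measure α}
    [IsFiniteMeasure ρ] {h : α → ℝ} (hm : Measurable h) (h0 : ∀ x, 0 ≤ h x) {C s : ℝ} (hs : 0 < s)
    (hs1 : s < 1) (htail : ∀ t, 0 < t → ρ {x | t ≤ h x} ≤ ENNReal.ofReal (C * Real.exp (-t))) :
    ∫⁻ x, ENNReal.ofReal (Real.exp (s * h x)) ∂ρ ≠ ∞ := by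
  have hcont : Continuous fun t => s * Real.exp (s * t) := by fun_prop
  have hprim (a : ℝ) : ∫ t in 0..a, s * Real.exp (s * t) = Real.exp (s * a) - 1 := by
    rw [intervalIntegral.integral_eq_sub_of_hasDerivAt (f := fun t => Real.exp (s * t))
      (fun t _ => by simpa [mul_comm] using ((hasDerivAt_id t).const_mul s).exp)
      (hcont.intervalIntegrable 0 a), mul_zero, Real.exp_zero]
  have hlayer := lintegral_comp_eq_lintegral_meas_le_mul ρ (.of_forall h0) hm.aemeasurable
    (fun t _ => hcont.intervalIntegrable 0 t) (.of_forall fun t => by positivity)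
  have hint : Integrable (fun t => C * s * Real.exp ((s - 1) * t)) (volume.restrict (Ioi 0)) :=
    (integrableOn_exp_mul_Ioi (by linarith) 0).const_mul _
  have hbound : ∫⁻ x, ENNReal.ofReal (Real.exp (s * h x) - 1) ∂ρ < ∞ := by
    simp only [hprim] at hlayer
    rw [hlayer]
    refine (setLIntegral_mono' measurableSet_Ioi fun t ht => ?_).trans_lt hint.lintegral_lt_top
    calc ρ {x | t ≤ h x} * ENNReal.ofReal (s * Real.exp (s * t))
        ≤ ENNReal.ofReal (C * Real.exp (-t)) * ENNReal.ofReal (s * Real.exp (s * t)) := by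
          gcongr
          exact htail t ht
      _ = ENNReal.ofReal (C * s * Real.exp ((s - 1) * t)) := by
          rw [← ENNReal.ofReal_mul' (by positivity), mul_mul_mul_comm, ← Real.exp_add]
          ring_nf
  refine ne_top_of_le_ne_top (ENNReal.add_ne_top.2 ⟨hbound.ne, measure_ne_top ρ univ⟩) ?_
  calc ∫⁻ x, ENNReal.ofReal (Real.exp (s * h x)) ∂ρ
      ≤ ∫⁻ x, (ENNReal.ofReal (Real.exp (s * h x) - 1) + 1) ∂ρ := by
        refine lintegral_mono fun x => ?_
        rw [← ENNReal.ofReal_one, ← ENNReal.ofReal_add _ zero_le_one, sub_add_cancel]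
        exact sub_nonneg.2 (Real.one_le_exp (mul_nonneg hs.le (h0 x)))
    _ = _ := by rw [lintegral_add_right _ measurable_const, lintegral_one]

/-! ### The noisy system as a random map -/

namespace NoisySystem

variable {n : ℕ} (S : NoisySystem n)

lemma measurableSet_X : MeasurableSet S.X := S.isCompact_X.measurableSet

instance : CompactSpace S.X := isCompact_iff_compactSpace.1 S.isCompact_X

/-- Lebesgue measure on `X`. -/
def vol : Measure S.X := Measure.comap Subtype.val (volume : Measure (Euc n))

lemma vol_apply (A : Set S.X) : S.vol A = volume (Subtype.val '' A : Set (Euc n)) :=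
  comap_subtype_coe_apply S.measurableSet_X _ _

instance : IsFiniteMeasure S.vol := by
  constructor
  rw [S.vol_apply, image_univ, Subtype.range_coe]
  exact S.isCompact_X.measure_lt_top

/-- Lebesgue measure on `X` with the constant density `(2σ)⁻ⁿ`: it dominates the law of every state
after time `0`. -/
def stepBound : Measure S.X := (ENNReal.ofReal (2 * S.σ))⁻¹ ^ n • S.vol

lemma inv_ofReal_two_mul_σ_ne_top : (ENNReal.ofReal (2 * S.σ))⁻¹ ≠ ∞ := by
  simpa using S.σ_pos

instance : IsFiniteMeasure S.stepBound :=
  S.vol.smul_finite (ENNReal.pow_ne_top S.inv_ofReal_two_mul_σ_ne_top)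

lemma map_val_ν : S.ν.map Subtype.val =
    (ENNReal.ofReal (2 * S.σ))⁻¹ • (volume : Measure ℝ).restrict (Icc (-S.σ) S.σ) := by
  rw [ν, Measure.map_smul, map_comap_subtype_coe measurableSet_Icc]

instance : IsProbabilityMeasure S.ν := by
  have hmap : S.ν.map Subtype.val univ = 1 := by
    rw [map_val_ν, Measure.smul_apply, Measure.restrict_apply_univ, Real.volume_Icc,
      sub_neg_eq_add, ← two_mul, smul_eq_mul]
    exact ENNReal.inv_mul_cancel (by simpa using S.σ_pos) ENNReal.ofReal_ne_top
  rw [Measure.map_apply measurable_subtype_coe .univ, preimage_univ] at hmap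
  exact ⟨hmap⟩

lemma measurable_coe_noise : Measurable fun (w : S.Noise) j => (w j : ℝ) := by
  fun_prop

lemma map_coe_noise_le :
    (Measure.pi fun _ : Fin n => S.ν).map (fun w j => (w j : ℝ)) ≤
      (ENNReal.ofReal (2 * S.σ))⁻¹ ^ n • (volume : Measure (Fin n → ℝ)) := by
  have : IsProbabilityMeasure (S.ν.map Subtype.val) :=
    Measure.isProbabilityMeasure_map measurable_subtype_coe.aemeasurable
  have hmap : (Measure.pi fun _ : Fin n => S.ν).map (fun w j => (w j : ℝ)) =
      Measure.pi fun _ => S.ν.map Subtype.val :=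
    Measure.pi_map_pi fun _ => measurable_subtype_coe.aemeasurable
  have hpi : Measure.pi (fun _ : Fin n => S.ν.map Subtype.val) =
      (ENNReal.ofReal (2 * S.σ))⁻¹ ^ n •
        (volume : Measure (Fin n → ℝ)).restrict (univ.pi fun _ => Icc (-S.σ) S.σ) := by
    refine Measure.pi_eq fun s hs => ?_
    simp only [map_val_ν, Measure.smul_apply, smul_eq_mul, Measure.restrict_apply (hs _),
      Measure.restrict_apply (MeasurableSet.univ_pi hs), ← pi_inter_distrib, volume_pi_pi,
      Finset.prod_mul_distrib, Finset.prod_const, Finset.card_univ, Fintype.card_fin]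
  rw [hmap, hpi]
  gcongr
  exact Measure.restrict_le_self

/-- The i.i.d. random maps `x ↦ f(x) + w`. -/
def randomMap : RandomMap S.Noise S.X where
  law := Measure.pi fun _ => S.ν
  step w x := ⟨S.f x + WithLp.toLp 2 (fun j => (w j : ℝ)), S.maps_to x x.2 w⟩
  isProbabilityMeasure_law := inferInstance
  measurable_step := by
    have hf : Measurable fun x : S.X => S.f x :=
      (continuousOn_iff_continuous_domRestrict.1 S.continuousOn_f).measurable
    exact ((hf.comp measurable_snd).add <| (PiLp.continuous_toLp 2 _).measurable.comp <|
      S.measurable_coe_noise.comp measurable_fst).subtype_mk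

instance : IsProbabilityMeasure S.ℙ := inferInstanceAs (IsProbabilityMeasure S.randomMap.pathLaw)

lemma transition_le_stepBound (x : S.X) : S.randomMap.transition x ≤ S.stepBound := by
  refine Measure.le_iff.2 fun A hA => ?_
  have hA' : MeasurableSet (Subtype.val '' A : Set (Euc n)) := S.measurableSet_X.subtype_image hA
  have htranslate : MeasurePreserving fun u : Fin n → ℝ => S.f x + WithLp.toLp 2 u :=
    (measurePreserving_add_left volume (S.f x)).comp (PiLp.volume_preserving_toLp (Fin n))
  set B : Set (Fin n → ℝ) := (fun u => S.f x + WithLp.toLp 2 u) ⁻¹' (Subtype.val '' A) with hB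
  have hpre : (fun w => S.randomMap.step w x) ⁻¹' A = (fun (w : S.Noise) j => (w j : ℝ)) ⁻¹' B := by
    conv_lhs => rw [← preimage_image_eq A Subtype.val_injective]
    rfl
  rw [RandomMap.transition_apply, Measure.map_apply (S.randomMap.measurable_step_left x) hA, hpre,
    ← Measure.map_apply S.measurable_coe_noise (htranslate.measurable hA')]
  refine (S.map_coe_noise_le B).trans_eq ?_
  rw [stepBound, Measure.smul_apply, Measure.smul_apply, hB,
    htranslate.measure_preimage hA'.nullMeasurableSet, S.vol_apply]

lemma iter_succ' (k : ℕ) (ω : S.Ω) (x : S.X) :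
    S.iter (k + 1) ω x = S.iter k (S.θ ω) (S.fω ω x) := by
  induction k with
  | zero => rfl
  | succ k ih => rw [iter, ih, iter, ← Function.iterate_succ_apply]

lemma iter_eq_randomMap_iter (k : ℕ) (ω : S.Ω) (x : S.X) :
    S.iter k ω x = S.randomMap.iter k ω x := by
  induction k generalizing ω x with
  | zero => rfl
  | succ k ih => exact (S.iter_succ' k ω x).trans (ih _ _)

lemma map_iter_succ_le (k : ℕ) (x : S.X) :
    S.ℙ.map (fun ω => S.iter (k + 1) ω x) ≤ S.stepBound := by
  simp only [iter_eq_randomMap_iter]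
  exact (S.randomMap.map_iter (k + 1) x).trans_le
    (kernel_pow_succ_le S.transition_le_stepBound k x)

variable {S}

lemma ℙ_fω_mem {A : Set S.X} (hA : MeasurableSet A) (x : S.X) :
    S.ℙ {ω | S.fω ω x ∈ A} = S.randomMap.transition x A := by
  have h := congrArg (fun m => m A) (S.randomMap.map_iter 1 x)
  rw [pow_one] at h
  exact (Measure.map_apply (S.randomMap.measurable_iter_left 1 x) hA).symm.trans h

lemma isStationary_iff_invariant {m : Measure S.X} :
    S.IsStationary m ↔ S.randomMap.transition.Invariant m := by
  have hbind {A : Set S.X} (hA : MeasurableSet A) :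
      ∫⁻ x, S.ℙ {ω | S.fω ω x ∈ A} ∂m = m.bind S.randomMap.transition A := by
    rw [Measure.bind_apply hA S.randomMap.transition.aemeasurable]
    exact lintegral_congr fun x => ℙ_fω_mem hA x
  refine ⟨fun h => Measure.ext fun A hA => ?_, fun h A hA => ?_⟩
  · rw [← hbind hA, h A hA]
  · rw [hbind hA, h.def]

namespace IsErgodicComponent

variable {Y : Set S.X} {μ : Measure S.X}

lemma transition_compl (hY : S.IsErgodicComponent Y μ) : ∀ x ∈ Y, S.randomMap.transition x Yᶜ = 0 :=
  fun x hx => by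
    rw [← ℙ_fω_mem hY.1.compl x]
    exact hY.2.1 x hx

/-- Indecomposable stationary measures are ergodic for the skew product. -/
lemma eq_of_invariant (hY : S.IsErgodicComponent Y μ) {m : Measure S.X} [IsProbabilityMeasure m]
    (hm : S.randomMap.transition.Invariant m) (hmY : m Yᶜ = 0) : m = μ := by
  obtain ⟨-, -, ⟨_, hμ, -⟩, -, huniq⟩ := hY
  exact eq_of_invariant_of_forall_isIndecomposable S.transition_le_stepBound
    (isStationary_iff_invariant.1 hμ) (fun m' _ hm' hind hm'Y => huniq m'
      ⟨‹_›, isStationary_iff_invariant.2 hm', RandomMap.ergodic_skewProduct hm' hind⟩ hm'Y) hm hmY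

end IsErgodicComponent

end NoisySystem

/-! ### The distance to the critical set -/

namespace NoisySystem

variable {n : ℕ} (S : NoisySystem n)

/-- The closed `r`-neighbourhood of the critical set in `X`; for `r = 0` it is the closure of the
critical set. -/
def critTube (r : ℝ) : Set S.X := Subtype.val ⁻¹' Metric.cthickening r S.crit

/-- The volume of the `r`-neighbourhood of the critical set is `O(r)`. -/
def CritTubeBound : Prop :=
  ∃ C : ℝ, ∀ r : ℝ, 0 < r → r ≤ 1 → S.vol (S.critTube r) ≤ ENNReal.ofReal (C * r)

/-- `log⁺ (1 / dist(x, 𝒞))`. The junk value `0⁻¹ = 0` makes it vanish on the closure of the critical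
set, and everywhere if the critical set is empty. -/
def logDist (x : S.X) : ℝ := Real.posLog (Metric.infDist (x : Euc n) S.crit)⁻¹

/-- `logDist` on the `δ`-neighbourhood of the critical set, and `0` elsewhere: for `δ ≤ 1` this is
`-log dist_δ(x, 𝒞)` away from the closure of the critical set. -/
def truncLogDist (δ : ℝ) : S.X → ℝ := (S.critTube δ).indicator S.logDist

lemma isClosed_critTube (r : ℝ) : IsClosed (S.critTube r) :=
  Metric.isClosed_cthickening.preimage continuous_subtype_val

lemma critTube_mono : Monotone S.critTube :=
  fun _ _ h => preimage_mono (Metric.cthickening_mono h _)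

lemma measurable_logDist : Measurable S.logDist := by
  have : Measurable fun x : S.X => Metric.infDist (x : Euc n) S.crit :=
    ((Metric.continuous_infDist_pt _).comp continuous_subtype_val).measurable
  exact measurable_const.max this.inv.log

lemma measurable_truncLogDist (δ : ℝ) : Measurable (S.truncLogDist δ) :=
  S.measurable_logDist.indicator (S.isClosed_critTube δ).measurableSet

variable {S} {x : S.X}

lemma logDist_nonneg : 0 ≤ S.logDist x := Real.posLog_nonneg

lemma notMem_crit (hx : x ∉ S.critTube 0) : (x : Euc n) ∉ S.crit :=
  fun h => hx (Metric.self_subset_cthickening _ h)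

lemma logDist_of_mem (hx : x ∈ S.critTube 0) : S.logDist x = 0 := by
  rw [critTube, Metric.cthickening_zero, mem_preimage] at hx
  simp [logDist, Metric.infDist_zero_of_mem_closure hx]

lemma mem_critTube_of_le_logDist {t : ℝ} (ht : 0 < t) (h : t ≤ S.logDist x) :
    x ∈ S.critTube (Real.exp (-t)) := by
  have hlog : t ≤ -Real.log (Metric.infDist (x : Euc n) S.crit) := by
    rw [← Real.log_inv]
    exact (le_max_iff.1 h).resolve_left ht.not_ge
  have hpos : 0 < Metric.infDist (x : Euc n) S.crit := by
    refine Metric.infDist_nonneg.lt_of_ne' fun h0 => ?_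
    rw [h0, Real.log_zero, neg_zero] at hlog
    exact ht.not_ge hlog
  have htop : Metric.infEDist (x : Euc n) S.crit ≠ ∞ := (ENNReal.toReal_pos_iff.1 hpos).2.ne
  refine (ENNReal.le_ofReal_iff_toReal_le htop (Real.exp_pos _).le).2 ?_
  exact (Real.log_le_iff_le_exp hpos).1 (by linarith)

lemma abs_truncLogDist_le (δ : ℝ) (x : S.X) : |S.truncLogDist δ x| ≤ S.logDist x := by
  rw [truncLogDist, abs_of_nonneg (indicator_nonneg (fun _ _ => logDist_nonneg) x)]
  exact indicator_le_self' (fun _ _ => logDist_nonneg) x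

lemma neg_log_distTrunc {δ : ℝ} (hδ : δ ≤ 1) (hx : x ∉ S.critTube 0) :
    -ENNReal.log (S.distTrunc δ x) = (S.truncLogDist δ x : EReal) := by
  have h0 : Metric.infEDist (x : Euc n) S.crit ≠ 0 := by
    rwa [critTube, Metric.cthickening_zero, mem_preimage, Metric.mem_closure_iff_infEDist_zero]
      at hx
  by_cases hxδ : x ∈ S.critTube δ
  · have h1 : Metric.infEDist (x : Euc n) S.crit ≤ 1 := by
      simpa [critTube, Metric.mem_cthickening_iff] using S.critTube_mono hδ hxδ
    have htop := ne_top_of_le_ne_top ENNReal.one_ne_top h1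
    have hle : 1 ≤ (Metric.infDist (x : Euc n) S.crit)⁻¹ :=
      one_le_inv_iff₀.2 ⟨ENNReal.toReal_pos h0 htop, ENNReal.toReal_mono ENNReal.one_ne_top h1⟩
    rw [distTrunc, if_neg (not_lt.2 hxδ), ENNReal.log_pos_real h0 htop, truncLogDist,
      indicator_of_mem hxδ, logDist, Real.posLog_eq_log (hle.trans (le_abs_self _)), Real.log_inv]
    rfl
  · rw [distTrunc, if_pos (not_le.1 hxδ), truncLogDist, indicator_of_notMem hxδ]
    simp

lemma tendsto_truncLogDist (x : S.X) :
    Tendsto (fun δ => S.truncLogDist δ x) (𝓝 0) (𝓝 0) := by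
  by_cases hx : x ∈ S.critTube 0
  · have h0 (δ : ℝ) : S.truncLogDist δ x = 0 := by
      simp only [truncLogDist, indicator_apply_eq_zero, logDist_of_mem hx, implies_true]
    simp only [h0, tendsto_const_nhds]
  · have hx' : (x : Euc n) ∉ closure S.crit := by
      rwa [critTube, Metric.cthickening_zero] at hx
    refine tendsto_const_nhds.congr' ?_
    filter_upwards [Metric.eventually_notMem_cthickening_of_infEDist_pos hx'] with δ hδ
    exact (indicator_of_notMem (s := S.critTube δ) hδ _).symm

namespace CritTubeBound

variable {K β : ℝ} {φ : S.X → ℝ} {μ : Measure S.X}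

lemma vol_critTube_zero (h : S.CritTubeBound) : S.vol (S.critTube 0) = 0 := by
  obtain ⟨C, hC⟩ := h
  have hlim : Tendsto (fun r => ENNReal.ofReal (C * r)) (𝓝[>] 0) (𝓝 0) := by
    have hcont : Continuous fun r => ENNReal.ofReal (C * r) :=
      ENNReal.continuous_ofReal.comp (continuous_const_mul C)
    simpa using (hcont.tendsto 0).mono_left nhdsWithin_le_nhds
  refine le_antisymm (ge_of_tendsto hlim ?_) zero_le
  filter_upwards [Ioc_mem_nhdsGT one_pos] with r hr
  exact (measure_mono (S.critTube_mono hr.1.le)).trans (hC r hr.1 hr.2)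

lemma ae_notMem_critTube (h : S.CritTubeBound) (hμ : μ ≤ S.stepBound) :
    ∀ᵐ x ∂μ, x ∉ S.critTube 0 :=
  ae_mono hμ <| Measure.smul_absolutelyContinuous.ae_le <|
    measure_eq_zero_iff_ae_notMem.1 h.vol_critTube_zero

lemma ae_iter_notMem_critTube (h : S.CritTubeBound) (hx : x ∉ S.critTube 0) :
    ∀ᵐ ω ∂S.ℙ, ∀ i, S.iter i ω x ∉ S.critTube 0 := by
  refine ae_all_iff.2 fun i => ?_
  cases i with
  | zero => exact .of_forall fun _ => hx
  | succ i =>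
    have hmeas : Measurable fun ω => S.iter (i + 1) ω x := by
      simp only [iter_eq_randomMap_iter]
      exact S.randomMap.measurable_iter_left (i + 1) x
    exact ae_of_ae_map hmeas.aemeasurable (h.ae_notMem_critTube (S.map_iter_succ_le i x))

/-- The volume of `{logDist ≥ t}` is `O(e⁻ᵗ)`. -/
lemma lintegral_exp_ne_top (h : S.CritTubeBound) (hβ : 0 < β)
    (hφ : ∀ x, |φ x| ≤ K + β * S.logDist x) :
    ∫⁻ x, ENNReal.ofReal (Real.exp ((2 * β)⁻¹ * |φ x|)) ∂S.stepBound ≠ ∞ := by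
  obtain ⟨C, hC⟩ := h
  have hlog : ∫⁻ x, ENNReal.ofReal (Real.exp (2⁻¹ * S.logDist x)) ∂S.vol ≠ ∞ :=
    lintegral_exp_mul_ne_top_of_measure_le S.measurable_logDist (fun _ => logDist_nonneg)
      (by norm_num) (by norm_num) fun t ht =>
        (measure_mono fun _ => mem_critTube_of_le_logDist ht).trans
          (hC _ (Real.exp_pos _) (Real.exp_le_one_iff.2 (by linarith)))
  rw [stepBound, lintegral_smul_measure]
  refine ENNReal.mul_ne_top (ENNReal.pow_ne_top S.inv_ofReal_two_mul_σ_ne_top) ?_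
  refine ne_top_of_le_ne_top
    (ENNReal.mul_ne_top (ENNReal.ofReal_ne_top (r := Real.exp ((2 * β)⁻¹ * K))) hlog) ?_
  rw [← lintegral_const_mul' _ _ ENNReal.ofReal_ne_top]
  refine lintegral_mono fun x => ?_
  rw [← ENNReal.ofReal_mul (Real.exp_pos _).le, ← Real.exp_add]
  gcongr
  calc (2 * β)⁻¹ * |φ x| ≤ (2 * β)⁻¹ * (K + β * S.logDist x) := by gcongr; exact hφ x
    _ = (2 * β)⁻¹ * K + 2⁻¹ * S.logDist x := by field_simp

lemma integrable_logDist (h : S.CritTubeBound) (hμ : μ ≤ S.stepBound) :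
    Integrable S.logDist μ := by
  refine Integrable.mono_measure ?_ hμ
  have hle (x) : |S.logDist x| ≤ 0 + 1 * S.logDist x := by
    rw [abs_of_nonneg logDist_nonneg, zero_add, one_mul]
  exact integrable_of_lintegral_exp_ne_top (by norm_num) S.measurable_logDist
    S.measurable_logDist.abs (fun _ => le_rfl) (h.lintegral_exp_ne_top one_pos hle)

lemma eventually_integral_truncLogDist_lt (h : S.CritTubeBound) (hμ : μ ≤ S.stepBound) {ε : ℝ}
    (hε : 0 < ε) : ∀ᶠ δ in 𝓝 (0 : ℝ), ∫ x, S.truncLogDist δ x ∂μ < ε := by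
  have hlim : Tendsto (fun δ => ∫ x, S.truncLogDist δ x ∂μ) (𝓝 0) (𝓝 (∫ _, (0 : ℝ) ∂μ)) :=
    tendsto_integral_filter_of_dominated_convergence S.logDist
      (.of_forall fun δ => (S.measurable_truncLogDist δ).aestronglyMeasurable)
      (.of_forall fun δ => .of_forall (abs_truncLogDist_le δ)) (h.integrable_logDist hμ)
      (.of_forall tendsto_truncLogDist)
  rw [integral_zero] at hlim
  exact hlim.eventually_lt_const hε

end CritTubeBound

lemma isCompact_unitCube (k : ℕ) : IsCompact (unitCube k) := by
  have hpre : unitCube k = (WithLp.equiv 2 _) ⁻¹' Icc 0 1 := by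
    ext t
    simp [unitCube, Pi.le_def, forall_and]
  rw [hpre]
  exact (PiLp.homeomorph 2 _).isCompact_preimage.2 isCompact_Icc

lemma convex_unitCube (k : ℕ) : Convex ℝ (unitCube k) :=
  fun _ hs _ ht _ _ ha hb hab j => convex_Icc (0 : ℝ) 1 (hs j) (ht j) ha hb hab

lemma CritInHypersurface.critTubeBound (hn : 0 < n) (hC : S.CritInHypersurface) :
    S.CritTubeBound := by
  obtain ⟨N, g, -, hg, -, hcrit, -⟩ := hC
  have hLip (i) : ∃ L, LipschitzOnWith L (g i) (unitCube (n - 1)) :=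
    (hg i).exists_lipschitzOnWith one_ne_zero (convex_unitCube _) (isCompact_unitCube _)
  choose L hL using hLip
  choose C hC using fun i => exists_measure_thickening_image_le volume
    (isCompact_unitCube _).isBounded (hL i) 2
  have hcodim : (Module.finrank ℝ (Euc n) : ℤ) - Module.finrank ℝ (Euc (n - 1)) = 1 := by
    simp only [finrank_euclideanSpace_fin]
    omega
  simp only [hcodim, zpow_one] at hC
  refine ⟨∑ i, |C i| * 2, fun r hr hr1 => ?_⟩
  have hsub : Metric.cthickening r S.crit ⊆
      ⋃ i, Metric.thickening (2 * r) (g i '' unitCube (n - 1)) := by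
    rw [← Metric.thickening_iUnion]
    exact (Metric.cthickening_subset_thickening' (by positivity) (by linarith) _).trans
      (Metric.thickening_subset_of_subset _ hcrit)
  calc S.vol (S.critTube r)
      ≤ ∑ i, volume (Metric.thickening (2 * r) (g i '' unitCube (n - 1))) := by
        rw [S.vol_apply]
        exact (measure_mono ((image_preimage_subset _ _).trans hsub)).trans
          (measure_iUnion_fintype_le _ _)
    _ ≤ ∑ i, ENNReal.ofReal (|C i| * (2 * r)) := by
        gcongr with i
        refine (hC i _ (by positivity) (by linarith)).trans ?_
        gcongr
        exact le_abs_self _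
    _ = ENNReal.ofReal ((∑ i, |C i| * 2) * r) := by
        rw [← ENNReal.ofReal_sum_of_nonneg fun i _ => by positivity, Finset.sum_mul]
        simp only [mul_assoc]

end NoisySystem

/-! ### The norm of the inverse derivative -/

lemma abs_log_norm_symm_le {E F : Type*} [NormedAddCommGroup E] [NormedSpace ℝ E] [Nontrivial E]
    [NormedAddCommGroup F] [NormedSpace ℝ F] (e : E ≃L[ℝ] F) {M : ℝ}
    (h : ‖(e : E →L[ℝ] F)‖ ≤ M) (h' : ‖(e.symm : F →L[ℝ] E)‖ ≤ M) :
    |Real.log ‖(e.symm : F →L[ℝ] E)‖| ≤ Real.log M := by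
  have hpos := e.norm_symm_pos
  have hinv : ‖(e.symm : F →L[ℝ] E)‖⁻¹ ≤ M :=
    ((inv_le_iff_one_le_mul₀ hpos).2 e.one_le_norm_mul_norm_symm).trans h
  rw [abs_le', ← Real.log_inv]
  exact ⟨Real.log_le_log hpos h', Real.log_le_log (inv_pos.2 hpos) hinv⟩

namespace NoisySystem

variable {n : ℕ} (S : NoisySystem n)

/-- `B⁻¹ d^β ‖u‖ ≤ ‖df(x) u‖ ≤ B d^{-β} ‖u‖` off the critical set, where `d = dist(x, 𝒞)`. If the
critical set is empty then `d` is `0` and the bounds are void. -/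
def CritPowerBound : Prop :=
  ∃ B β : ℝ, 0 < B ∧ 0 < β ∧ ∀ x ∈ S.X \ S.crit, ∀ u : Euc n,
    Metric.infDist x S.crit ^ β * ‖u‖ ≤ B * ‖S.df x u‖ ∧
    Metric.infDist x S.crit ^ β * ‖S.df x u‖ ≤ B * ‖u‖

/-- `log ‖df(x)⁻¹‖` away from the closure of the critical set, and `0` on it. -/
def logNormInvReal : S.X → ℝ := (S.critTube 0)ᶜ.indicator fun x => Real.log (S.normInv x)

variable {S} {x : S.X}

lemma CritNondegenerate.critPowerBound (hB : S.CritNondegenerate) : S.CritPowerBound := by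
  obtain ⟨B, β, hB, hβ, h, -⟩ := hB
  exact ⟨B, β, one_pos.trans hB, hβ, h⟩

lemma IsC1Holder.continuousOn_df (hf : S.IsC1Holder) : ContinuousOn S.df (S.X \ S.crit) := by
  obtain ⟨α, hα, -, h⟩ := hf
  intro x hx
  obtain ⟨U, hU, K, hK⟩ := h x hx
  have hlim : Tendsto (fun y => K * ‖y - x‖ ^ α) (𝓝[S.X \ S.crit] x) (𝓝 0) := by
    have hcont : Continuous fun y => K * ‖y - x‖ ^ α :=
      continuous_const.mul ((continuous_sub_right x).norm.rpow_const fun _ => .inr hα.le)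
    simpa [hα.ne'] using (hcont.tendsto x).mono_left nhdsWithin_le_nhds
  refine tendsto_iff_norm_sub_tendsto_zero.2 (squeeze_zero' (.of_forall fun _ => norm_nonneg _) ?_
    hlim)
  filter_upwards [nhdsWithin_le_nhds hU, self_mem_nhdsWithin] with y hyU hy
  exact hK y ⟨hyU, hy⟩ x ⟨mem_of_mem_nhds hU, hx⟩

lemma isInvertible_df (hx : (x : Euc n) ∉ S.crit) : (S.df x).IsInvertible :=
  (not_not.1 fun h => hx ⟨x.2, h⟩).2.2

lemma normInv_eq {e : Euc n ≃L[ℝ] Euc n} {y : Euc n} (he : (e : Euc n →L[ℝ] Euc n) = S.df y) :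
    S.normInv y = ‖(e.symm : Euc n →L[ℝ] Euc n)‖ := by
  rw [normInv, ← he, ContinuousLinearMap.inverse_equiv]

lemma logNormInv_eq (hx : x ∉ S.critTube 0) : S.logNormInv x = (S.logNormInvReal x : EReal) := by
  rw [logNormInv, if_neg (notMem_crit hx), logNormInvReal, indicator_of_mem hx]

lemma continuousOn_log_normInv (hn : 0 < n) (hdf : ContinuousOn S.df (S.X \ S.crit)) :
    ContinuousOn (fun x : S.X => Real.log (S.normInv x)) (S.critTube 0)ᶜ := by
  have : Nonempty (Fin n) := ⟨⟨0, hn⟩⟩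
  have hdf' : ContinuousOn (fun x : S.X => S.df x) (S.critTube 0)ᶜ :=
    hdf.comp continuous_subtype_val.continuousOn fun x hx => ⟨x.2, notMem_crit hx⟩
  intro x hx
  obtain ⟨e, he⟩ := isInvertible_df (notMem_crit hx)
  have hinv : ContinuousAt ContinuousLinearMap.inverse (S.df x) :=
    ((isInvertible_df (notMem_crit hx)).contDiffAt_map_inverse (n := 0)).continuousAt
  have hne : S.normInv x ≠ 0 := by
    rw [normInv_eq he]
    exact e.norm_symm_pos.ne'
  exact (hinv.comp_continuousWithinAt (f := fun y : S.X => S.df y) (hdf' x hx)).norm.log hne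

lemma measurable_logNormInvReal (hn : 0 < n) (hdf : ContinuousOn S.df (S.X \ S.crit)) :
    Measurable S.logNormInvReal := by
  classical
  rw [logNormInvReal, ← piecewise_eq_indicator]
  exact (continuousOn_log_normInv hn hdf).measurable_piecewise continuousOn_const
    (S.isClosed_critTube 0).measurableSet.compl

lemma abs_log_normInv_le {B β : ℝ} (hn : 0 < n) (hB : 0 < B) (hβ : 0 < β)
    (hd : 0 < Metric.infDist (x : Euc n) S.crit) (hx : (x : Euc n) ∉ S.crit)
    (h : ∀ u : Euc n, Metric.infDist (x : Euc n) S.crit ^ β * ‖u‖ ≤ B * ‖S.df x u‖ ∧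
      Metric.infDist (x : Euc n) S.crit ^ β * ‖S.df x u‖ ≤ B * ‖u‖) :
    |Real.log (S.normInv x)| ≤ Real.log B + β * S.logDist x := by
  have : Nonempty (Fin n) := ⟨⟨0, hn⟩⟩
  obtain ⟨e, he⟩ := isInvertible_df hx
  set d := Metric.infDist (x : Euc n) S.crit
  have hdβ : 0 < d ^ β := Real.rpow_pos_of_pos hd β
  simp only [← he, ContinuousLinearEquiv.coe_coe] at h
  rw [normInv_eq he]
  calc |Real.log ‖(e.symm : Euc n →L[ℝ] Euc n)‖| ≤ Real.log (B / d ^ β) := by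
        refine abs_log_norm_symm_le e
          (ContinuousLinearMap.opNorm_le_bound _ (by positivity) fun u => ?_)
          (ContinuousLinearMap.opNorm_le_bound _ (by positivity) fun u => ?_)
        · rw [div_mul_eq_mul_div, le_div_iff₀' hdβ]
          exact (h u).2
        · rw [div_mul_eq_mul_div, le_div_iff₀' hdβ]
          simpa using (h (e.symm u)).1
    _ = Real.log B + β * Real.log d⁻¹ := by
        rw [Real.log_div hB.ne' hdβ.ne', Real.log_rpow hd, Real.log_inv]
        ring
    _ ≤ Real.log B + β * S.logDist x := by
        gcongr
        exact le_max_right _ _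

lemma CritPowerBound.exists_abs_logNormInvReal_le (h : S.CritPowerBound) (hn : 0 < n)
    (hdf : ContinuousOn S.df (S.X \ S.crit)) :
    ∃ K β : ℝ, 0 < β ∧ ∀ x, |S.logNormInvReal x| ≤ K + β * S.logDist x := by
  obtain ⟨B, β, hB, hβ, hbound⟩ := h
  rcases S.crit.eq_empty_or_nonempty with hempty | hne
  · have hcont : ContinuousOn (fun x : S.X => Real.log (S.normInv x)) univ := by
      simpa [critTube, hempty] using continuousOn_log_normInv hn hdf
    obtain ⟨K, hK⟩ := isCompact_univ.exists_bound_of_continuousOn hcont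
    refine ⟨K, β, hβ, fun x => ?_⟩
    simpa [logNormInvReal, critTube, logDist, hempty] using hK x (mem_univ x)
  · refine ⟨|Real.log B|, β, hβ, fun x => ?_⟩
    by_cases hx : x ∈ S.critTube 0
    · rw [logNormInvReal, indicator_of_notMem (not_not.2 hx), logDist_of_mem hx]
      simp
    · have hd : 0 < Metric.infDist (x : Euc n) S.crit := by
        rw [critTube, Metric.cthickening_zero] at hx
        exact (Metric.infDist_pos_iff_notMem_closure hne).1 hx
      rw [logNormInvReal, indicator_of_mem hx]
      refine (abs_log_normInv_le hn hB hβ hd (notMem_crit hx)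
        (hbound x ⟨x.2, notMem_crit hx⟩)).trans ?_
      gcongr
      exact le_abs_self _

end NoisySystem

/-! ### Averages of observables with logarithmic poles -/

lemma ExponentiallySmall.add {b b' : ℕ → ℝ≥0∞} (hb : ExponentiallySmall b)
    (hb' : ExponentiallySmall b') : ExponentiallySmall (b + b') := by
  obtain ⟨C, γ, hγ0, hγ1, h⟩ := hb
  obtain ⟨C', γ', hγ0', hγ1', h'⟩ := hb'
  refine ⟨|C| + |C'|, max γ γ', hγ0.trans_le (le_max_left _ _), max_lt hγ1 hγ1', fun k => ?_⟩
  calc b k + b' k ≤ ENNReal.ofReal (C * γ ^ k) + ENNReal.ofReal (C' * γ' ^ k) :=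
        add_le_add (h k) (h' k)
    _ ≤ ENNReal.ofReal (|C| * max γ γ' ^ k) + ENNReal.ofReal (|C'| * max γ γ' ^ k) := by
        gcongr
        exacts [le_abs_self C, le_max_left _ _, le_abs_self C', le_max_right _ _]
    _ = ENNReal.ofReal ((|C| + |C'|) * max γ γ' ^ k) := by
        rw [add_mul, ENNReal.ofReal_add (by positivity) (by positivity)]

lemma ExponentiallySmall.exists_lt {b : ℕ → ℝ≥0∞} (hb : ExponentiallySmall b) :
    ∃ C γ : ℝ, 1 < C ∧ 0 < γ ∧ γ < 1 ∧ ∀ k, b k < ENNReal.ofReal (C * γ ^ k) := by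
  obtain ⟨C, γ, hγ0, hγ1, h⟩ := hb
  refine ⟨|C| + 2, γ, by linarith [abs_nonneg C], hγ0, hγ1, fun k => (h k).trans_lt ?_⟩
  rw [ENNReal.ofReal_lt_ofReal_iff (by positivity)]
  gcongr
  linarith [le_abs_self C]

lemma coe_sum_ereal {ι : Type*} (s : Finset ι) (u : ι → ℝ) :
    ((∑ i ∈ s, u i : ℝ) : EReal) = ∑ i ∈ s, (u i : EReal) :=
  map_sum (⟨⟨Real.toEReal, EReal.coe_zero⟩, EReal.coe_add⟩ : ℝ →+ EReal) u s

namespace NoisySystem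

variable {n : ℕ} {S : NoisySystem n} {g : S.X → EReal} {φ : S.X → ℝ} {Y : Set S.X}
  {μ : Measure S.X}

lemma measure_lt_average_le (htube : S.CritTubeBound)
    (hg : ∀ x ∉ S.critTube 0, g x = (φ x : EReal)) {x : S.X} (hx : x ∉ S.critTube 0) {k : ℕ}
    (hk : 0 < k) (a : ℝ) :
    S.ℙ {ω | (a : EReal) < (∑ i ∈ Finset.range (k + 1), g (S.iter i ω x)) / (k : EReal)} ≤
      S.ℙ {ω | k * a - φ x ≤ S.randomMap.pathSum φ k ω x} := by
  refine measure_mono_ae ?_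
  filter_upwards [htube.ae_iter_notMem_critTube hx] with ω hω
    (hlt : (a : EReal) < (∑ i ∈ Finset.range (k + 1), g (S.iter i ω x)) / (k : EReal))
  have hsum : ∑ i ∈ Finset.range (k + 1), g (S.iter i ω x) =
      ((S.randomMap.pathSum φ k ω x + φ x : ℝ) : EReal) := by
    rw [Finset.sum_congr rfl fun i _ => hg _ (hω i), ← coe_sum_ereal, Finset.sum_range_succ']
    simp only [iter_eq_randomMap_iter]
    rfl
  rw [hsum, ← EReal.coe_natCast, ← EReal.coe_div, EReal.coe_lt_coe_iff,
    lt_div_iff₀' (Nat.cast_pos.2 hk)] at hlt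
  exact (sub_lt_iff_lt_add.2 hlt).le

namespace IsErgodicComponent

lemma le_stepBound (hY : S.IsErgodicComponent Y μ) : μ ≤ S.stepBound := by
  have := hY.2.2.1.1
  exact le_of_invariant (isStationary_iff_invariant.1 hY.2.2.1.2.1) S.transition_le_stepBound

/-- The `β * c` in the threshold absorbs the contribution of the initial point, which is all that
the excluded neighbourhood of the critical set has to control. -/
lemma exponentiallySmall_measure_lt_average (hY : S.IsErgodicComponent Y μ)
    (htube : S.CritTubeBound) (hg : ∀ x ∉ S.critTube 0, g x = (φ x : EReal)) (hφ : Measurable φ)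
    {K β : ℝ} (hβ : 0 < β) (hφβ : ∀ x, |φ x| ≤ K + β * S.logDist x) {a c : ℝ} (hc : 0 < c)
    (ha : ∫ y, φ y ∂μ + β * c < a) :
    ∃ b, ExponentiallySmall b ∧
      ∀ x ∈ Y, ∀ k : ℕ, 0 < k → x ∉ S.critTube (Real.exp (-(c * k))) →
        S.ℙ {ω | (a : EReal) < (∑ i ∈ Finset.range (k + 1), g (S.iter i ω x)) / (k : EReal)} ≤
          b k := by
  set η : ℝ := (a - β * c - ∫ y, φ y ∂μ) / 2 with hη
  have hη0 : 0 < η := half_pos (by linarith)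
  have hexp := htube.lintegral_exp_ne_top hβ hφβ
  have hs : 0 < (2 * β)⁻¹ := by positivity
  obtain ⟨N, hN, hmean⟩ := exists_sum_integral_pow_le S.transition_le_stepBound hY.1
    hY.transition_compl (fun m _ hm hmY => hY.eq_of_invariant hm hmY)
    (integrable_of_lintegral_exp_ne_top hs hφ hφ.abs (fun _ => le_rfl) hexp) hη0
  obtain ⟨b, hb, hsmall⟩ := S.randomMap.exponentiallySmall_measure_le_pathSum
    S.transition_le_stepBound hY.transition_compl hφ hs hexp hN hmean hη0 K
  refine ⟨b, hb, fun x hx k hk hxk => ?_⟩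
  have hlog : S.logDist x < c * k :=
    not_le.1 fun h => hxk (mem_critTube_of_le_logDist (by positivity) h)
  have hφx : φ x ≤ K + β * (c * k) :=
    (le_abs_self _).trans ((hφβ x).trans (by gcongr))
  have hx0 : x ∉ S.critTube 0 := fun h => hxk (S.critTube_mono (Real.exp_pos _).le h)
  refine (measure_lt_average_le htube hg hx0 hk a).trans ((measure_mono ?_).trans (hsmall x hx k))
  intro ω (hω : k * a - φ x ≤ S.randomMap.pathSum φ k ω x)
  refine le_trans ?_ hω
  rw [hη]
  linarith

lemma lam_eq (hY : S.IsErgodicComponent Y μ) (htube : S.CritTubeBound) :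
    S.lam Y μ = ∫ x, S.logNormInvReal x ∂μ := by
  have hmem : ∀ᵐ x ∂μ, x ∈ Y := hY.2.2.2.1
  rw [lam, Measure.restrict_eq_self_of_ae_mem hmem]
  refine integral_congr_ae ?_
  filter_upwards [htube.ae_notMem_critTube hY.le_stepBound] with x hx
  rw [logNormInv_eq hx, EReal.toReal_coe]

lemma exponentiallySmall_measure_lt_Sav (hY : S.IsErgodicComponent Y μ) (htube : S.CritTubeBound)
    (hn : 0 < n) (hdf : ContinuousOn S.df (S.X \ S.crit)) {K β c ε : ℝ} (hβ : 0 < β)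
    (hbound : ∀ x, |S.logNormInvReal x| ≤ K + β * S.logDist x) (hc : 0 < c) (hcε : β * c < ε) :
    ∃ b, ExponentiallySmall b ∧
      ∀ x ∈ Y, ∀ k : ℕ, 0 < k → x ∉ S.critTube (Real.exp (-(c * k))) →
        S.ℙ {ω | ((S.lam Y μ + ε : ℝ) : EReal) < S.Sav k ω x} ≤ b k :=
  hY.exponentiallySmall_measure_lt_average htube (g := fun x => S.logNormInv x)
    (a := S.lam Y μ + ε) (fun _ => logNormInv_eq) (measurable_logNormInvReal hn hdf) hβ hbound hc
    (by rw [hY.lam_eq htube]; linarith)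

lemma exponentiallySmall_measure_lt_Zav (hY : S.IsErgodicComponent Y μ) (htube : S.CritTubeBound)
    {δ c ε : ℝ} (hδ : δ ≤ 1) (hc : 0 < c) (hcε : ∫ x, S.truncLogDist δ x ∂μ + c < ε) :
    ∃ b, ExponentiallySmall b ∧
      ∀ x ∈ Y, ∀ k : ℕ, 0 < k → x ∉ S.critTube (Real.exp (-(c * k))) →
        S.ℙ {ω | (ε : EReal) < S.Zav δ k ω x} ≤ b k := by
  have hg : ∀ x ∉ S.critTube 0, -ENNReal.log (S.distTrunc δ x) = (S.truncLogDist δ x : EReal) :=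
    fun _ => neg_log_distTrunc hδ
  have hbound : ∀ x, |S.truncLogDist δ x| ≤ 0 + 1 * S.logDist x := fun x => by
    simpa using abs_truncLogDist_le δ x
  exact hY.exponentiallySmall_measure_lt_average htube hg (S.measurable_truncLogDist δ) one_pos
    hbound hc (by rwa [one_mul])

end IsErgodicComponent

lemma CritTubeBound.exponentiallySmall (htube : S.CritTubeBound) {c : ℝ} (hc : 0 < c) :
    ExponentiallySmall fun k : ℕ => S.vol (S.critTube (Real.exp (-(c * k)))) := by
  obtain ⟨C, hC⟩ := htube
  refine ⟨C, Real.exp (-c), Real.exp_pos _, Real.exp_lt_one_iff.2 (neg_lt_zero.2 hc), fun k => ?_⟩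
  rw [← Real.exp_nat_mul, mul_neg, mul_comm (k : ℝ)]
  exact hC _ (Real.exp_pos _) (Real.exp_le_one_iff.2 (neg_nonpos.2 (by positivity)))

end NoisySystem

theorem proposition3p1_general {n : ℕ} (hn : 0 < n) {S : NoisySystem n}
    (hdf : ContinuousOn S.df (S.X \ S.crit)) (htube : S.CritTubeBound) (hpow : S.CritPowerBound)
    {Y : Set S.X} {μ : Measure S.X} (hY : S.IsErgodicComponent Y μ) {ε : ℝ} (hε : 0 < ε) :
    ∃ δ₀ : ℝ, 0 < δ₀ ∧ ∀ δ : ℝ, 0 < δ → δ < δ₀ →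
      ∃ (C γ : ℝ) (A : ℕ → Set S.X), 1 < C ∧ 0 < γ ∧ γ < 1 ∧
        ∀ k : ℕ, MeasurableSet (A k) ∧
          volume (Subtype.val '' A k : Set (Euc n)) ≤ ENNReal.ofReal (C * γ ^ k) ∧
          ∀ x ∈ Y, x ∉ A k →
            S.ℙ {ω | ((S.lam Y μ + ε : ℝ) : EReal) < S.Sav k ω x ∨
                (ε : EReal) < S.Zav δ k ω x} < ENNReal.ofReal (C * γ ^ k) := by
  obtain ⟨K, β, hβ, hbound⟩ := hpow.exists_abs_logNormInvReal_le hn hdf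
  obtain ⟨δ₀, hδ₀, hδ₀ε⟩ := Metric.eventually_nhds_iff.1
    (htube.eventually_integral_truncLogDist_lt hY.le_stepBound (half_pos hε))
  obtain ⟨c, hc, hβcε, hcε⟩ : ∃ c : ℝ, 0 < c ∧ β * c < ε ∧ c < ε / 2 :=
    ⟨ε / (2 * (β + 1)), by positivity,
      by rw [mul_div_assoc', div_lt_iff₀ (by positivity)]; nlinarith,
      by rw [div_lt_div_iff₀ (by positivity) two_pos]; nlinarith [mul_pos hβ hε]⟩
  refine ⟨min δ₀ 1, by positivity, fun δ hδ0 hδ => ?_⟩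
  have hδε : ∫ x, S.truncLogDist δ x ∂μ < ε / 2 := hδ₀ε (by
    rw [Real.dist_0_eq_abs, abs_of_pos hδ0]
    exact hδ.trans_le (min_le_left _ _))
  obtain ⟨b₁, hb₁, hS⟩ := hY.exponentiallySmall_measure_lt_Sav htube hn hdf hβ hbound hc hβcε
  obtain ⟨b₂, hb₂, hZ⟩ := hY.exponentiallySmall_measure_lt_Zav htube (ε := ε)
    (hδ.le.trans (min_le_right _ _)) hc (by linarith)
  obtain ⟨C, γ, hC, hγ0, hγ1, hlt⟩ := ((htube.exponentiallySmall hc).add (hb₁.add hb₂)).exists_lt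
  simp only [Pi.add_apply] at hlt
  refine ⟨C, γ, fun k => S.critTube (Real.exp (-(c * k))), hC, hγ0, hγ1, fun k =>
    ⟨(S.isClosed_critTube _).measurableSet, ?_, fun x hx hxk => ?_⟩⟩
  · rw [← S.vol_apply]
    exact le_self_add.trans (hlt k).le
  rcases k.eq_zero_or_pos with rfl | hk
  · exact prob_le_one.trans_lt (by simpa using hC)
  · rw [ofPred_or]
    calc S.ℙ ({ω | ((S.lam Y μ + ε : ℝ) : EReal) < S.Sav k ω x} ∪ {ω | (ε : EReal) < S.Zav δ k ω x})
        ≤ b₁ k + b₂ k :=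
          (measure_union_le _ _).trans (add_le_add (hS x hx k hk hxk) (hZ x hx k hk hxk))
      _ < ENNReal.ofReal (C * γ ^ k) := le_add_self.trans_lt (hlt k)

end

theorem proposition3p1 (n : ℕ) (hn : 0 < n) (S : NoisySystem n)
    (hf : S.IsC1Holder) (hC : S.CritInHypersurface) (hB : S.CritNondegenerate)
    (Y : Set S.X) (μ : Measure S.X)
    (hY : S.IsErgodicComponent Y μ) (hlam : S.lam Y μ < 0) :
    ∃ ε₀ : ℝ, 0 < ε₀ ∧ ∀ ε : ℝ, 0 < ε → ε < ε₀ →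
      ∃ δ₀ : ℝ, 0 < δ₀ ∧ ∀ δ : ℝ, 0 < δ → δ < δ₀ →
        ∃ (C γ : ℝ) (A : ℕ → Set S.X), 1 < C ∧ 0 < γ ∧ γ < 1 ∧
          ∀ k : ℕ, MeasurableSet (A k) ∧
            volume (Subtype.val '' A k : Set (Euc n)) ≤ ENNReal.ofReal (C * γ ^ k) ∧
            ∀ x ∈ Y, x ∉ A k →
              S.ℙ {ω | ((S.lam Y μ + ε : ℝ) : EReal) < S.Sav k ω x ∨
                  (ε : EReal) < S.Zav δ k ω x} < ENNReal.ofReal (C * γ ^ k) :=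
  ⟨1, one_pos, fun _ hε _ => proposition3p1_general hn hf.continuousOn_df (hC.critTubeBound hn)
    hB.critPowerBound hY hε⟩
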